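/- Let $\alpha\in[0,\infty]$ and $n\ge 1$, and let $X_1,\dots,X_n$ be independent integer-valued random variables, each taking only finitely many values with positive probability and each discrete log-concave: its probability mass function $p$ satisfies $p(j)^2\ge p(j-1)p(j+1)$ for all $j\in\mathbb Z$, and $\{j : p(j)>0\}$ is an interval of integers. For a random variable $Y$ that takes finitely many values with positive probability, with mass function $p$, let $N_\alpha(Y)=e^{2H_\alpha(Y)}$, where $H_\alpha(Y)=\frac1{1-\alpha}\log\sum_x p(x)^\alpha$ for $\alpha\in(0,1)\cup(1,\infty)$, $H_0(Y)=\log|\{x:p(x)>0\}|$, $H_1(Y)=-\sum_x p(x)\log p(x)$ and $H_\infty(Y)=-\log\sup_x p(x)$. Then, for every $a\in(\mathbb R\setminus\{0\})^n$, $$N_\alpha(a_1X_1+\cdots+a_nX_n)\ \ge\ 1+c\sum_{k=1}^n\mathrm{Var}(X_k)$$ with $c=1$. Moreover, if $1<\alpha\le 2$, this holds with $c=4$; and for all other $\alpha\in[0,\infty]$ it holds with $c=2$ provided that, in addition, each $X_k$ is symmetric about a point (there is a real number $m_k$ such that $X_k$ and $2m_k-X_k$ have the same distribution). -/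

import Mathlib

open MeasureTheory ProbabilityTheory
open scoped ENNReal

noncomputable section

/-- The probability mass function `x ↦ P(X = x)` of a discrete random variable `X`. -/
def massFunction {Ω E : Type*} [MeasurableSpace Ω] (μ : Measure Ω) (X : Ω → E) (x : E) : ℝ :=
  μ.real (X ⁻¹' {x})

/-- An integer-valued random variable is finitely supported: it has only finitely many atoms. -/
def FinitelySupported {Ω : Type*} [MeasurableSpace Ω] (μ : Measure Ω) (X : Ω → ℤ) : Prop :=
  (Function.support (massFunction μ X)).Finite

/-- An integer-valued random variable is discrete log-concave: its mass function `p` satisfies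
`p(j)² ≥ p(j-1) p(j+1)` for all `j`, and the support of `p` is an interval of integers. -/
structure DiscreteLogConcave {Ω : Type*} [MeasurableSpace Ω] (μ : Measure Ω) (X : Ω → ℤ) :
    Prop where
  sq_ge : ∀ j : ℤ,
    massFunction μ X (j - 1) * massFunction μ X (j + 1) ≤ massFunction μ X j ^ 2
  ordConnected_support : (Function.support (massFunction μ X)).OrdConnected

/-- The law of `X` is symmetric about some real point `c`: `X` and its reflection `2c - X`
have the same distribution. -/
def SymmetricAboutPoint {Ω : Type*} [MeasurableSpace Ω] (μ : Measure Ω) (X : Ω → ℤ) : Prop :=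
  ∃ c : ℝ, IdentDistrib (fun ω => (X ω : ℝ)) (fun ω => 2 * c - (X ω : ℝ)) μ μ

/-- The Rényi entropy of order `α ∈ [0, ∞]` of a random variable with finitely many values.
For `α ∉ {0, 1, ∞}` points of mass zero contribute `0 ^ α = 0` to the sum. -/
def renyiEntropy {Ω E : Type*} [MeasurableSpace Ω] (μ : Measure Ω) (α : ℝ≥0∞) (X : Ω → E) : ℝ :=
  if α = 0 then Real.log (Function.support (massFunction μ X)).ncard
  else if α = 1 then -∑' x : E, massFunction μ X x * Real.log (massFunction μ X x)
  else if α = ∞ then -Real.log (⨆ x : E, massFunction μ X x)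
  else 1 / (1 - α.toReal) * Real.log (∑' x : E, massFunction μ X x ^ α.toReal)

/-- The Rényi entropy power `N_α(X) = exp(2 H_α(X))`. -/
def renyiEntropyPower {Ω E : Type*} [MeasurableSpace Ω] (μ : Measure Ω) (α : ℝ≥0∞)
    (X : Ω → E) : ℝ :=
  Real.exp (2 * renyiEntropy μ α X)

end

/-! Rényi entropy is nonincreasing in its order, so a bound at order `∞` serves every `α` and a
bound at order 2 serves `1 < α ≤ 2`. With `V` the sum of the variances, it remains to bound the
largest mass `M` of `Y = ∑ a_k X_k` by `M² (1 + c V) ≤ 1`, and its collision probability `q = ∑ P(Y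
= y)²` by `q² (1 + 4 V) ≤ 1`.

Symmetric case, `c = 2`: the integer sum `∑ X_k` is again symmetric log-concave and majorizes `Y`
whatever the nonzero weights (`symmetric_sum_majorizes`), so `M` is at most the largest mass of one
symmetric log-concave law of variance `V`. Comparison with geometric tails bounds that mass
(`sq_mul_le_one_of_symmetric`).

Collision probability: `q` is the mass at 0 of `Y - Y'` for an independent copy `Y'`. This is a
weighted sum of the symmetric log-concave variables `X_k - X_k'`, of total variance `2 V`, so the
symmetric case gives the constant 4.

General case, `c = 1`: if the variables split into two groups of variances `V₁`, `V₂`,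
Cauchy–Schwarz gives `M² ≤ q₁ q₂`, which suffices when `(1 + V₁ + V₂)² ≤ (1 + 4 V₁)(1 + 4 V₂)`. Such
a split exists unless one variance exceeds `2 + 13 W`, where `W` is the sum of the others. Then
induction bounds the masses of the remaining sum by `(1 + W)^(-1/2)`, and
`LogConcaveSeq.sum_mul_sq_le` bounds the average of the dominant mass function against them. -/

/-! ### Log-concave sequences on the integers and their convolutions. -/

/-- A nonnegative sequence on `ℤ` is log-concave without internal zeros: an outer product is at
most an inner product with the same index sum. -/
structure LogConcaveSeq (f : ℤ → ℝ) : Prop where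
  nonneg : ∀ i, 0 ≤ f i
  mul_le : ∀ i j k l : ℤ, i ≤ j → i ≤ k → i + l = j + k → f i * f l ≤ f j * f k

theorem DiscreteLogConcave.logConcaveSeq {Ω : Type*} [MeasurableSpace Ω] {μ : Measure Ω}
    {X : Ω → ℤ} (h : DiscreteLogConcave μ X) : LogConcaveSeq (massFunction μ X) := by
  obtain ⟨hsq, hconn⟩ := h
  set f := massFunction μ X with hf
  have h0 : ∀ i, 0 ≤ f i := fun i => measureReal_nonneg
  refine ⟨h0, ?_⟩
  -- On a run of positive values the local inequalities chain together, since the common factor `f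
  -- (i + n)` can be cancelled. When the outer product is nonzero, the interval support supplies
  -- such a run.
  have ratio : ∀ (i : ℤ) (n : ℕ), (∀ t, i ≤ t → t ≤ i + n + 1 → 0 < f t) →
      f i * f (i + n + 1) ≤ f (i + 1) * f (i + n) := by
    intro i n
    induction n with
    | zero => intro _; simp [mul_comm]
    | succ n ih =>
      intro hpos
      have h1 := ih fun t ht1 ht2 => hpos t ht1 (by push_cast; omega)
      have h2 := hsq (i + n + 1)
      rw [show i + (n : ℤ) + 1 - 1 = i + n by ring] at h2
      have hp := hpos (i + n) (by omega) (by push_cast; omega)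
      have hp1 := hpos (i + n + 1) (by omega) (by push_cast; omega)
      rw [show i + ((n + 1 : ℕ) : ℤ) + 1 = i + n + 1 + 1 by push_cast; ring,
        show i + ((n + 1 : ℕ) : ℤ) = i + n + 1 by push_cast; ring]
      refine le_of_mul_le_mul_left ?_ hp
      calc f (i + n) * (f i * f (i + n + 1 + 1)) = f i * (f (i + n) * f (i + n + 1 + 1)) := by ring
        _ ≤ f i * f (i + n + 1) ^ 2 := by gcongr; exact h0 i
        _ = (f i * f (i + n + 1)) * f (i + n + 1) := by ring
        _ ≤ (f (i + 1) * f (i + n)) * f (i + n + 1) := by gcongr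
        _ = _ := by ring
  have key : ∀ (n : ℕ) (i l : ℤ), i + 2 * n ≤ l → f i * f l ≤ f (i + n) * f (l - n) := by
    intro n
    induction n with
    | zero => intro i l _; simp
    | succ n ih =>
      intro i l hil
      push_cast at hil
      by_cases hz : f i * f l = 0
      · rw [hz]; exact mul_nonneg (h0 _) (h0 _)
      have hi : i ∈ Function.support f := left_ne_zero_of_mul hz
      have hl : l ∈ Function.support f := right_ne_zero_of_mul hz
      have hpos : ∀ t, i ≤ t → t ≤ l → 0 < f t := fun t h1 h2 =>
        lt_of_le_of_ne (h0 t) (Ne.symm (hconn.out hi hl ⟨h1, h2⟩))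
      have h1 := ratio i (l - i - 1).toNat (fun t h1 h2 => hpos t h1 (by omega))
      rw [show i + ((l - i - 1).toNat : ℤ) + 1 = l by omega,
        show i + ((l - i - 1).toNat : ℤ) = l - 1 by omega] at h1
      have h2 := ih (i + 1) (l - 1) (by omega)
      rw [show i + 1 + (n : ℤ) = i + ((n + 1 : ℕ) : ℤ) by push_cast; ring,
        show l - 1 - (n : ℤ) = l - ((n + 1 : ℕ) : ℤ) by push_cast; ring] at h2
      exact h1.trans h2
  intro i j k l hij hik hs
  wlog hjk : j ≤ k generalizing j k
  · rw [mul_comm (f j)]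
    exact this k j hik hij (by omega) (by omega)
  have := key (j - i).toNat i l (by omega)
  rwa [show i + ((j - i).toNat : ℤ) = j by omega, show l - ((j - i).toNat : ℤ) = k by omega] at this

/-- Log-concavity is preserved by convolution with a finitely supported sequence. -/
theorem LogConcaveSeq.conv {p g h : ℤ → ℝ} (hp : LogConcaveSeq p) (hg : LogConcaveSeq g)
    (F : Finset ℤ) (hF : ∀ t ∉ F, p t = 0) (hh : ∀ x, h x = ∑ t ∈ F, p t * g (x - t)) :
    LogConcaveSeq h := by
  refine ⟨fun i => hh i ▸ Finset.sum_nonneg fun t _ => mul_nonneg (hp.nonneg _) (hg.nonneg _), ?_⟩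
  intro i j k l hij hik hs
  obtain ⟨d, hd⟩ : ∃ d, d = j - i := ⟨_, rfl⟩
  -- `U` carries both `p t` and its translate `p (t - d)`, so all four values of `h` become sums
  -- over one index set.
  set U : Finset ℤ := F ∪ F.map (Equiv.addRight d).toEmbedding with hU
  have e1 : ∀ x, h x = ∑ t ∈ U, g (x - t) * p t := by
    intro x
    rw [hh x, ← Finset.sum_subset (Finset.subset_union_left : F ⊆ U)]
    · exact Finset.sum_congr rfl fun t _ => mul_comm _ _
    · intro t _ ht; rw [hF t ht, mul_zero]
  have e2 : ∀ x, h (x - d) = ∑ t ∈ U, g (x - t) * p (t - d) := by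
    intro x
    rw [hh, ← Finset.sum_subset (Finset.subset_union_right : F.map (Equiv.addRight d).toEmbedding ⊆ U)]
    · rw [Finset.sum_map]
      refine Finset.sum_congr rfl fun t _ => ?_
      simp only [Equiv.coe_toEmbedding, Equiv.coe_addRight, add_sub_cancel_right]
      rw [mul_comm, show x - d - t = x - (t + d) by ring]
    · intro t _ ht
      rw [hF (t - d), mul_zero]
      intro hmem
      exact ht (Finset.mem_map.2 ⟨t - d, hmem, by simp⟩)
  -- Cauchy–Binet: the 2×2 minor of `h` is a sum of products of minors of `g` and of `p`. For each
  -- pair `t`, `t'` the two factors have the same sign. The factor 2 comes from counting ordered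
  -- pairs.
  have main : 2 * (h j * h (l - d) - h (j - d) * h l) =
      ∑ t ∈ U, ∑ t' ∈ U, (g (j - t) * g (l - t') - g (j - t') * g (l - t)) *
        (p t * p (t' - d) - p t' * p (t - d)) := by
    have expand : ∀ (u v u' v' : ℤ → ℝ), ∑ t ∈ U, ∑ t' ∈ U, (u t * v t' - u t' * v t) *
        (u' t * v' t' - u' t' * v' t) =
        2 * ((∑ t ∈ U, u t * u' t) * (∑ t ∈ U, v t * v' t) -
          (∑ t ∈ U, u t * v' t) * (∑ t ∈ U, v t * u' t)) := by
      intro u v u' v'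
      have a1 := Finset.sum_mul_sum U U (fun t => u t * u' t) (fun t => v t * v' t)
      have a2 := Finset.sum_mul_sum U U (fun t => v t * v' t) (fun t => u t * u' t)
      have a3 := Finset.sum_mul_sum U U (fun t => u t * v' t) (fun t => v t * u' t)
      have a4 := Finset.sum_mul_sum U U (fun t => v t * u' t) (fun t => u t * v' t)
      have : ∑ t ∈ U, ∑ t' ∈ U, (u t * v t' - u t' * v t) * (u' t * v' t' - u' t' * v' t) =
          ∑ t ∈ U, ∑ t' ∈ U, (u t * u' t) * (v t' * v' t') +
          ∑ t ∈ U, ∑ t' ∈ U, (v t * v' t) * (u t' * u' t') -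
          ∑ t ∈ U, ∑ t' ∈ U, (u t * v' t) * (v t' * u' t') -
          ∑ t ∈ U, ∑ t' ∈ U, (v t * u' t) * (u t' * v' t') := by
        simp only [← Finset.sum_add_distrib, ← Finset.sum_sub_distrib]
        refine Finset.sum_congr rfl fun t _ => Finset.sum_congr rfl fun t' _ => ?_
        ring
      rw [this, ← a1, ← a2, ← a3, ← a4]; ring
    rw [e1 j, e1 l, e2 j, e2 l,
      expand (fun t => g (j - t)) (fun t => g (l - t)) p (fun t => p (t - d))]
  have hnn : 0 ≤ 2 * (h j * h (l - d) - h (j - d) * h l) := by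
    rw [main]
    refine Finset.sum_nonneg fun t _ => Finset.sum_nonneg fun t' _ => ?_
    rcases le_total t t' with htt | htt
    · refine mul_nonneg (sub_nonneg.2 ?_) (sub_nonneg.2 ?_)
      · exact hg.mul_le _ _ _ _ (by omega) (by omega) (by ring)
      · rw [mul_comm (p t')]
        exact hp.mul_le _ _ _ _ (by omega) (by omega) (by ring)
    · refine mul_nonneg_of_nonpos_of_nonpos (sub_nonpos.2 ?_) (sub_nonpos.2 ?_)
      · exact hg.mul_le _ _ _ _ (by omega) (by omega) (by ring)
      · rw [mul_comm (p t)]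
        exact hp.mul_le _ _ _ _ (by omega) (by omega) (by ring)
  rw [show j - d = i by omega, show l - d = k by omega] at hnn
  linarith

/-! ### One-sided moment inequalities. -/

/-- Exactly `j` pairs `(i, l)` satisfy `i + l + 1 = j`, so summing the hypothesis over pairs
produces the weight `j`; the pairs lie in a triangle inside the square on the right. -/
theorem mul_sum_index_mul_le {b u w : ℕ → ℝ} {c : ℝ} (N : ℕ) (hu : ∀ i, 0 ≤ u i)
    (hw : ∀ i, 0 ≤ w i) (h : ∀ i l, c * b (i + l + 1) ≤ u i * w l) :
    c * ∑ j ∈ Finset.range (N + 1), (j : ℝ) * b j ≤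
      (∑ i ∈ Finset.range N, u i) * ∑ i ∈ Finset.range N, w i := by
  rw [Finset.sum_range_succ', Nat.cast_zero, zero_mul, add_zero, Finset.mul_sum]
  calc ∑ n ∈ Finset.range N, c * (((n + 1 : ℕ) : ℝ) * b (n + 1))
      ≤ ∑ n ∈ Finset.range N, ∑ k ∈ Finset.range (n + 1), u k * w (n - k) := by
        refine Finset.sum_le_sum fun n _ => ?_
        have : c * (((n + 1 : ℕ) : ℝ) * b (n + 1)) =
            ∑ k ∈ Finset.range (n + 1), c * b (n + 1) := by
          rw [Finset.sum_const, Finset.card_range, nsmul_eq_mul]; ring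
        rw [this]
        refine Finset.sum_le_sum fun k hk => ?_
        have := h k (n - k)
        rwa [Nat.add_sub_cancel' (Nat.lt_succ_iff.1 (Finset.mem_range.1 hk))] at this
    _ = ∑ m ∈ Finset.range N, ∑ k ∈ Finset.range (N - m), u m * w k :=
        Finset.sum_range_diag_flip N fun m k => u m * w k
    _ ≤ ∑ m ∈ Finset.range N, ∑ k ∈ Finset.range N, u m * w k := by
        refine Finset.sum_le_sum fun m _ => Finset.sum_le_sum_of_subset_of_nonneg ?_ ?_
        · exact Finset.range_subset_range.2 (Nat.sub_le _ _)
        · exact fun k _ _ => mul_nonneg (hu _) (hw _)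
    _ = _ := (Finset.sum_mul_sum _ _ _ _).symm

/-- Log-concave sequences on `ℕ`. -/
structure LogConcaveNat (f : ℕ → ℝ) : Prop where
  nonneg : ∀ i, 0 ≤ f i
  mul_le : ∀ i j k l : ℕ, i ≤ j → i ≤ k → i + l = j + k → f i * f l ≤ f j * f k

namespace LogConcaveNat

variable {f : ℕ → ℝ} {N : ℕ}

/-- Sums `f 0 * f (i + l + 1) ≤ f i * f (l + 1)` over all pairs; geometric sequences are the extreme
case. -/
theorem apply_zero_mul_sum_le (hf : LogConcaveNat f) (hN : ∀ n, N ≤ n → f n = 0) :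
    f 0 * ∑ j ∈ Finset.range N, (j : ℝ) * f j ≤
      (∑ j ∈ Finset.range N, f j) * (∑ j ∈ Finset.range N, f j - f 0) := by
  have h := mul_sum_index_mul_le (b := f) (u := f) (w := fun l => f (l + 1)) (c := f 0) N
    hf.nonneg (fun _ => hf.nonneg _)
    (fun i l => hf.mul_le _ _ _ _ (by omega) (by omega) (by omega))
  have h2 : ∑ l ∈ Finset.range N, f (l + 1) = ∑ j ∈ Finset.range N, f j - f 0 := by
    rw [eq_sub_iff_add_eq, ← Finset.sum_range_succ', Finset.sum_range_succ, hN N le_rfl, add_zero]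
  rwa [Finset.sum_range_succ, hN N le_rfl, mul_zero, add_zero, h2] at h

/-- The tail sums `G` inherit `G 0 * G (i + l) ≤ G i * G l`. Summation by parts turns the first
moment into `∑ G (j + 1)` and the second factorial moment into `2 * ∑ j * G (j + 1)`, to which the
pair count applies. -/
theorem sum_mul_sum_le (hf : LogConcaveNat f) (hN : ∀ n, N ≤ n → f n = 0) :
    (∑ j ∈ Finset.range N, f j) * (∑ j ∈ Finset.range N, (j : ℝ) ^ 2 * f j -
      ∑ j ∈ Finset.range N, (j : ℝ) * f j) ≤ 2 * (∑ j ∈ Finset.range N, (j : ℝ) * f j) ^ 2 := by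
  set G : ℕ → ℝ := fun n => ∑ b ∈ Finset.range N, f (n + b) with hG
  have G0 : ∀ n, 0 ≤ G n := fun n => Finset.sum_nonneg fun _ _ => hf.nonneg _
  have GN : ∀ n, N ≤ n → G n = 0 := fun n hn => Finset.sum_eq_zero fun b _ => hN _ (by omega)
  have Gsub : ∀ n, f n = G n - G (n + 1) := by
    intro n
    have h1 : ∑ b ∈ Finset.range (N + 1), f (n + b) = G n := by
      rw [Finset.sum_range_succ, hN (n + N) (by omega), add_zero]
    have h2 : ∑ b ∈ Finset.range (N + 1), f (n + b) = G (n + 1) + f n := by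
      rw [Finset.sum_range_succ']
      congr 1
      exact Finset.sum_congr rfl fun b _ => by congr 1; ring
    linarith
  have split : ∀ n l, G n = ∑ a ∈ Finset.range l, f (n + a) + G (n + l) := by
    intro n l
    induction l with
    | zero => simp
    | succ l ih =>
      rw [Finset.sum_range_succ, ih, Gsub (n + l)]
      ring_nf
  have GLC : ∀ i l, G 0 * G (i + l) ≤ G i * G l := by
    intro i l
    have e0 := split 0 l
    have e1 := split i l
    have : (∑ a ∈ Finset.range l, f (0 + a)) * G (i + l) ≤
        (∑ a ∈ Finset.range l, f (i + a)) * G (0 + l) := by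
      rw [Finset.sum_mul_sum, Finset.sum_mul_sum]
      refine Finset.sum_le_sum fun a ha => Finset.sum_le_sum fun b _ => ?_
      have := Finset.mem_range.1 ha
      exact hf.mul_le _ _ _ _ (by omega) (by omega) (by omega)
    rw [zero_add] at e0 this
    rw [e0, e1]
    linarith
  have parts1 : ∀ n, ∑ j ∈ Finset.range n, (j : ℝ) * f j =
      ∑ j ∈ Finset.range n, G (j + 1) - n * G n := by
    intro n
    induction n with
    | zero => simp
    | succ n ih =>
      rw [Finset.sum_range_succ, Finset.sum_range_succ, ih, Gsub n]; push_cast; ring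
  have parts2 : ∀ n, ∑ j ∈ Finset.range n, (j : ℝ) ^ 2 * f j - ∑ j ∈ Finset.range n, (j : ℝ) * f j =
      2 * ∑ j ∈ Finset.range n, (j : ℝ) * G (j + 1) - n * (n - 1) * G n := by
    intro n
    induction n with
    | zero => simp
    | succ n ih =>
      have : ∑ j ∈ Finset.range n, (j : ℝ) ^ 2 * f j = ∑ j ∈ Finset.range n, (j : ℝ) * f j +
        (2 * ∑ j ∈ Finset.range n, (j : ℝ) * G (j + 1) - n * (n - 1) * G n) := by linarith
      rw [Finset.sum_range_succ, Finset.sum_range_succ, Finset.sum_range_succ, this, Gsub n]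
      push_cast; ring
  have p1 := parts1 N
  have p2 := parts2 N
  rw [GN N le_rfl, mul_zero, sub_zero] at p1 p2
  have h := mul_sum_index_mul_le (b := fun j => G (j + 1)) (u := fun i => G (i + 1))
    (w := fun i => G (i + 1)) (c := G 0) N (fun _ => G0 _) (fun _ => G0 _)
    (fun i l => by
      have := GLC (i + 1) (l + 1)
      rwa [show i + 1 + (l + 1) = i + l + 1 + 1 by ring] at this)
  rw [Finset.sum_range_succ, GN (N + 1) (by omega), mul_zero, add_zero] at h
  have hG0 : ∑ j ∈ Finset.range N, f j = G 0 := by simp [hG]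
  rw [p2, p1, hG0]
  nlinarith

end LogConcaveNat

/-! ### Variance against the size of an atom. -/

theorem sum_filter_eq_self {F : Finset ℤ} {f : ℤ → ℝ} (hF : ∀ z ∉ F, f z = 0) (x : ℤ) :
    ∑ z ∈ F with z = x, f z = f x := by
  rw [Finset.sum_filter, Finset.sum_ite_eq']
  split_ifs with h
  · rfl
  · exact (hF x h).symm

theorem sum_ge_eq_add_sum_gt {F : Finset ℤ} {f : ℤ → ℝ} (hF : ∀ z ∉ F, f z = 0) (x : ℤ) :
    ∑ z ∈ F with x ≤ z, f z = f x + ∑ z ∈ F with x < z, f z := by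
  rw [← sum_filter_eq_self hF x, Finset.sum_filter, Finset.sum_filter, Finset.sum_filter,
    ← Finset.sum_add_distrib]
  refine Finset.sum_congr rfl fun z _ => ?_
  rcases lt_trichotomy z x with h | h | h
  · simp [h.not_ge, h.ne, h.not_gt]
  · simp [h]
  · simp [h, h.ne', h.le]

theorem sum_le_eq_add_sum_lt {F : Finset ℤ} {f : ℤ → ℝ} (hF : ∀ z ∉ F, f z = 0) (x : ℤ) :
    ∑ z ∈ F with z ≤ x, f z = f x + ∑ z ∈ F with z < x, f z := by
  rw [← sum_filter_eq_self hF x, Finset.sum_filter, Finset.sum_filter, Finset.sum_filter,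
    ← Finset.sum_add_distrib]
  refine Finset.sum_congr rfl fun z _ => ?_
  rcases lt_trichotomy z x with h | h | h
  · simp [h, h.ne, h.le]
  · simp [h]
  · simp [h.not_ge, h.ne', h.not_gt]

theorem sum_eq_add_sum_lt_add_sum_gt {F : Finset ℤ} {f : ℤ → ℝ} (hF : ∀ z ∉ F, f z = 0) (x : ℤ) :
    ∑ z ∈ F, f z = f x + ∑ z ∈ F with x < z, f z + ∑ z ∈ F with z < x, f z := by
  rw [← sum_ge_eq_add_sum_gt hF, Finset.sum_filter, Finset.sum_filter, ← Finset.sum_add_distrib]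
  refine Finset.sum_congr rfl fun z _ => ?_
  rcases le_or_gt x z with h | h
  · simp [h, h.not_gt]
  · simp [h, h.not_ge]

namespace LogConcaveSeq

variable {f : ℤ → ℝ} {F : Finset ℤ}

theorem neg (hf : LogConcaveSeq f) : LogConcaveSeq fun z => f (-z) :=
  ⟨fun _ => hf.nonneg _, fun i j k l h1 h2 h3 => by
    rw [mul_comm, mul_comm (f (-j))]
    exact hf.mul_le _ _ _ _ (by omega) (by omega) (by omega)⟩

/-- Moment inequalities for the part of a log-concave sequence to the right of a point. -/
theorem right_moments (hf : LogConcaveSeq f) (hF : ∀ z ∉ F, f z = 0) (x : ℤ) :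
    f x * ∑ z ∈ F with x ≤ z, ((z : ℝ) - x) * f z ≤
        (∑ z ∈ F with x ≤ z, f z) * (∑ z ∈ F with x ≤ z, f z - f x) ∧
      (∑ z ∈ F with x ≤ z, f z) * (∑ z ∈ F with x ≤ z, ((z : ℝ) - x) ^ 2 * f z -
        ∑ z ∈ F with x ≤ z, ((z : ℝ) - x) * f z) ≤
        2 * (∑ z ∈ F with x ≤ z, ((z : ℝ) - x) * f z) ^ 2 := by
  obtain ⟨N, hN⟩ : ∃ N : ℕ, ∀ z ∈ F, z - x < N := by
    obtain ⟨M, hM⟩ := F.bddAbove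
    exact ⟨(M - x + 1).toNat, fun z hz => by have := hM hz; omega⟩
  set r : ℕ → ℝ := fun n => f (x + n) with hr
  have hrLC : LogConcaveNat r := ⟨fun _ => hf.nonneg _, fun i j k l h1 h2 h3 =>
    hf.mul_le _ _ _ _ (by omega) (by omega) (by omega)⟩
  have hrN : ∀ n, N ≤ n → r n = 0 := fun n hn => hF _ fun hmem => by
    have := hN _ hmem
    omega
  have conv : ∀ k : ℕ, ∑ z ∈ F with x ≤ z, ((z : ℝ) - x) ^ k * f z =
      ∑ n ∈ Finset.range N, (n : ℝ) ^ k * r n := by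
    intro k
    refine Finset.sum_of_injOn (fun z => (z - x).toNat) ?_ ?_ ?_ ?_
    · intro a ha b hb hab
      simp only [Finset.coe_filter, Set.mem_ofPred_eq] at ha hb hab
      omega
    · intro a ha
      simp only [Finset.coe_filter, Set.mem_ofPred_eq, Finset.coe_range, Set.mem_Iio] at ha ⊢
      have := hN a ha.1
      omega
    · intro n _ hn
      have : r n = 0 := hF _ fun hmem => hn ⟨x + n, by simpa using hmem, by simp⟩
      rw [this, mul_zero]
    · intro z hz
      have hz' := (Finset.mem_filter.1 hz).2
      obtain ⟨n, rfl⟩ : ∃ n : ℕ, z = x + n := ⟨(z - x).toNat, by omega⟩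
      simp [hr]
  have c0 := conv 0
  have c1 := conv 1
  simp only [pow_zero, one_mul, pow_one] at c0 c1
  rw [c0, c1, conv 2]
  have := hrLC.apply_zero_mul_sum_le hrN
  rw [show r 0 = f x by simp [hr]] at this
  exact ⟨this, hrLC.sum_mul_sum_le hrN⟩

/-- Moment inequalities for the part of a log-concave sequence to the left of a point. -/
theorem left_moments (hf : LogConcaveSeq f) (hF : ∀ z ∉ F, f z = 0) (x : ℤ) :
    f x * ∑ z ∈ F with z ≤ x, ((x : ℝ) - z) * f z ≤
        (∑ z ∈ F with z ≤ x, f z) * (∑ z ∈ F with z ≤ x, f z - f x) ∧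
      (∑ z ∈ F with z ≤ x, f z) * (∑ z ∈ F with z ≤ x, ((x : ℝ) - z) ^ 2 * f z -
        ∑ z ∈ F with z ≤ x, ((x : ℝ) - z) * f z) ≤
        2 * (∑ z ∈ F with z ≤ x, ((x : ℝ) - z) * f z) ^ 2 := by
  have h := hf.neg.right_moments (F := F.map (Equiv.neg ℤ).toEmbedding) (fun z hz =>
    hF _ fun hmem => hz (Finset.mem_map.2 ⟨-z, hmem, by simp⟩)) (-x)
  simpa [Finset.filter_map, Function.comp_def, neg_add_eq_sub] using h

/-- The basic variance inequality for a log-concave probability sequence. -/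
theorem variance_mul_sq_le (hf : LogConcaveSeq f) (hF : ∀ z ∉ F, f z = 0)
    (h1 : ∑ z ∈ F, f z = 1) (x : ℤ) :
    (∑ z ∈ F, (z : ℝ) ^ 2 * f z - (∑ z ∈ F, (z : ℝ) * f z) ^ 2) * f x ^ 2 ≤
      1 - f x - 2 * (∑ z ∈ F with x < z, f z) * (∑ z ∈ F with z < x, f z) := by
  have hψ : ∀ ψ : ℤ → ℝ, ∀ z ∉ F, ψ z * f z = 0 := fun ψ z hz => by rw [hF z hz, mul_zero]
  have splitsum := fun ψ : ℤ → ℝ => sum_eq_add_sum_lt_add_sum_gt (hψ ψ) x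
  have rsum := fun ψ : ℤ → ℝ => sum_ge_eq_add_sum_gt (hψ ψ) x
  have lsum := fun ψ : ℤ → ℝ => sum_le_eq_add_sum_lt (hψ ψ) x
  obtain ⟨hr1, hr2⟩ := hf.right_moments hF x
  obtain ⟨hl1, hl2⟩ := hf.left_moments hF x
  have r0 := rsum fun _ => 1
  have l0 := lsum fun _ => 1
  have r1 := rsum fun z => (z : ℝ) - x
  have l1 := lsum fun z => (x : ℝ) - z
  have r2 := rsum fun z => ((z : ℝ) - x) ^ 2
  have l2 := lsum fun z => ((x : ℝ) - z) ^ 2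
  have s0 := splitsum fun _ => 1
  have s1 := splitsum fun z => (z : ℝ) - x
  have s2 := splitsum fun z => ((z : ℝ) - x) ^ 2
  simp only [one_mul, sub_self, zero_mul, zero_add, ne_eq, OfNat.ofNat_ne_zero, not_false_eq_true,
    zero_pow] at r0 l0 r1 l1 r2 l2 s0 s1 s2
  rw [r0, r1, r2] at hr2
  rw [r0, r1] at hr1
  rw [l0, l1, l2] at hl2
  rw [l0, l1] at hl1
  have hA : 0 ≤ ∑ z ∈ F with x < z, f z := Finset.sum_nonneg fun _ _ => hf.nonneg _
  have hB : 0 ≤ ∑ z ∈ F with z < x, f z := Finset.sum_nonneg fun _ _ => hf.nonneg _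
  have hα : 0 ≤ ∑ z ∈ F with x < z, ((z : ℝ) - x) * f z := Finset.sum_nonneg fun z hz =>
    mul_nonneg (sub_nonneg.2 (by exact_mod_cast (Finset.mem_filter.1 hz).2.le)) (hf.nonneg _)
  have hβ : 0 ≤ ∑ z ∈ F with z < x, ((x : ℝ) - z) * f z := Finset.sum_nonneg fun z hz =>
    mul_nonneg (sub_nonneg.2 (by exact_mod_cast (Finset.mem_filter.1 hz).2.le)) (hf.nonneg _)
  have m1 : ∑ z ∈ F with z < x, ((z : ℝ) - x) * f z =
      -∑ z ∈ F with z < x, ((x : ℝ) - z) * f z := by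
    rw [← Finset.sum_neg_distrib]; exact Finset.sum_congr rfl fun z _ => by ring
  have m2 : ∑ z ∈ F with z < x, ((z : ℝ) - x) ^ 2 * f z =
      ∑ z ∈ F with z < x, ((x : ℝ) - z) ^ 2 * f z :=
    Finset.sum_congr rfl fun z _ => by ring
  have v : ∑ z ∈ F, (z : ℝ) ^ 2 * f z - (∑ z ∈ F, (z : ℝ) * f z) ^ 2 =
      ∑ z ∈ F, ((z : ℝ) - x) ^ 2 * f z - (∑ z ∈ F, ((z : ℝ) - x) * f z) ^ 2 := by
    have e1 : ∑ z ∈ F, ((z : ℝ) - x) * f z = ∑ z ∈ F, (z : ℝ) * f z - x := by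
      simp only [sub_mul, Finset.sum_sub_distrib, ← Finset.mul_sum, h1, mul_one]
    have e2 : ∑ z ∈ F, ((z : ℝ) - x) ^ 2 * f z =
        ∑ z ∈ F, (z : ℝ) ^ 2 * f z - 2 * x * ∑ z ∈ F, (z : ℝ) * f z + x ^ 2 := by
      have : ∑ z ∈ F, ((z : ℝ) - x) ^ 2 * f z = ∑ z ∈ F, (z : ℝ) ^ 2 * f z -
          ∑ z ∈ F, 2 * x * ((z : ℝ) * f z) + ∑ z ∈ F, (x : ℝ) ^ 2 * f z := by
        rw [← Finset.sum_sub_distrib, ← Finset.sum_add_distrib]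
        exact Finset.sum_congr rfl fun z _ => by ring
      rw [this, ← Finset.mul_sum, ← Finset.mul_sum, h1, mul_one]
    rw [e1, e2]; ring
  rw [v, s1, s2, m1, m2]
  rw [h1] at s0
  have hp : 0 ≤ f x := hf.nonneg x
  generalize (∑ z ∈ F with x < z, f z) = A at *
  generalize (∑ z ∈ F with z < x, f z) = B at *
  generalize (∑ z ∈ F with x < z, ((z : ℝ) - x) * f z) = α at *
  generalize (∑ z ∈ F with z < x, ((x : ℝ) - z) * f z) = β at *
  generalize (∑ z ∈ F with x < z, ((z : ℝ) - x) ^ 2 * f z) = α₂ at *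
  generalize (∑ z ∈ F with z < x, ((x : ℝ) - z) ^ 2 * f z) = β₂ at *
  generalize f x = p at *
  clear v m1 m2 s1 s2 r0 l0 r1 l1 r2 l2 rsum lsum splitsum hψ
  rcases hp.eq_or_lt with rfl | hp
  · nlinarith
  have ha : 0 < p + A := by linarith
  have hb : 0 < p + B := by linarith
  -- In the rescaled moments `x'`, `y'` the bound on `p ^ 2` times the variance is a quadratic
  -- polynomial, nondecreasing in each variable over `0 ≤ x' ≤ A`, `0 ≤ y' ≤ B`. At the corner `(A,
  -- B)`, attained by geometric tails, it equals `1 - p - 2 * A * B`.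
  obtain ⟨x', hx'⟩ : ∃ x', p * α = (p + A) * x' := ⟨p * α / (p + A), by field_simp⟩
  obtain ⟨y', hy'⟩ : ∃ y', p * β = (p + B) * y' := ⟨p * β / (p + B), by field_simp⟩
  have hx0 : 0 ≤ x' := nonneg_of_mul_nonneg_right (hx' ▸ mul_nonneg hp.le hα) ha
  have hy0 : 0 ≤ y' := nonneg_of_mul_nonneg_right (hy' ▸ mul_nonneg hp.le hβ) hb
  have hxA : x' ≤ A := le_of_mul_le_mul_left (by linarith) ha
  have hyB : y' ≤ B := le_of_mul_le_mul_left (by linarith) hb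
  have hα₂ : p ^ 2 * α₂ ≤ p * ((p + A) * x') + 2 * (p + A) * x' ^ 2 := by
    refine le_of_mul_le_mul_left ?_ ha
    calc (p + A) * (p ^ 2 * α₂) = p ^ 2 * ((p + A) * (α₂ - α)) + (p + A) * p * (p * α) := by ring
      _ ≤ p ^ 2 * (2 * α ^ 2) + (p + A) * p * (p * α) := by gcongr
      _ = 2 * (p * α) ^ 2 + (p + A) * p * (p * α) := by ring
      _ = _ := by rw [hx']; ring
  have hβ₂ : p ^ 2 * β₂ ≤ p * ((p + B) * y') + 2 * (p + B) * y' ^ 2 := by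
    refine le_of_mul_le_mul_left ?_ hb
    calc (p + B) * (p ^ 2 * β₂) = p ^ 2 * ((p + B) * (β₂ - β)) + (p + B) * p * (p * β) := by ring
      _ ≤ p ^ 2 * (2 * β ^ 2) + (p + B) * p * (p * β) := by gcongr
      _ = 2 * (p * β) ^ 2 + (p + B) * p * (p * β) := by ring
      _ = _ := by rw [hy']; ring
  have hstart : (α₂ + β₂ - (α + -β) ^ 2) * p ^ 2 ≤ p * ((p + A) * x') + 2 * (p + A) * x' ^ 2 +
      (p * ((p + B) * y') + 2 * (p + B) * y' ^ 2) - ((p + A) * x' - (p + B) * y') ^ 2 := by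
    rw [← hx', ← hy'] at *
    nlinarith
  have hp1 : p = 1 - A - B := by linarith
  have ha1 : p + A = 1 - B := by linarith
  have hb1 : p + B = 1 - A := by linarith
  have stepx : p * ((p + A) * x') + 2 * (p + A) * x' ^ 2 +
      (p * ((p + B) * y') + 2 * (p + B) * y' ^ 2) - ((p + A) * x' - (p + B) * y') ^ 2 ≤
      p * ((p + A) * A) + 2 * (p + A) * A ^ 2 +
      (p * ((p + B) * y') + 2 * (p + B) * y' ^ 2) - ((p + A) * A - (p + B) * y') ^ 2 := by
    have h0 : 0 ≤ (A - x') * (p + A) * (p + 2 * (p + B) * y' + (2 - (p + A)) * (A + x')) := by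
      have : 0 ≤ 2 - (p + A) := by linarith
      have := sub_nonneg.2 hxA
      positivity
    nlinarith
  have stepy : p * ((p + A) * A) + 2 * (p + A) * A ^ 2 +
      (p * ((p + B) * y') + 2 * (p + B) * y' ^ 2) - ((p + A) * A - (p + B) * y') ^ 2 ≤
      p * ((p + A) * A) + 2 * (p + A) * A ^ 2 +
      (p * ((p + B) * B) + 2 * (p + B) * B ^ 2) - ((p + A) * A - (p + B) * B) ^ 2 := by
    have h0 : 0 ≤ (B - y') * (p + B) * (p + 2 * (p + A) * A + (2 - (p + B)) * (B + y')) := by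
      have : 0 ≤ 2 - (p + B) := by linarith
      have := sub_nonneg.2 hyB
      positivity
    nlinarith
  have fin : p * ((p + A) * A) + 2 * (p + A) * A ^ 2 +
      (p * ((p + B) * B) + 2 * (p + B) * B ^ 2) - ((p + A) * A - (p + B) * B) ^ 2 =
      1 - p - 2 * A * B := by
    rw [hp1]; ring
  linarith

/-- For a symmetric log-concave sequence, values decrease with the distance from the centre. -/
theorem le_of_abs_le (hf : LogConcaveSeq f) {γ : ℤ} (hsym : ∀ z, f (γ - z) = f z) {x y : ℤ}
    (h : |2 * y - γ| ≤ |2 * x - γ|) : f x ≤ f y := by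
  wlog hx : 2 * x ≤ γ generalizing x
  · rw [← hsym x]
    refine this ?_ (by omega)
    rwa [show 2 * (γ - x) - γ = -(2 * x - γ) by ring, abs_neg]
  wlog hy : 2 * y ≤ γ generalizing y
  · rw [← hsym y]
    refine this ?_ (by omega)
    rwa [show 2 * (γ - y) - γ = -(2 * y - γ) by ring, abs_neg]
  rw [abs_of_nonpos (by omega), abs_of_nonpos (by omega)] at h
  have := hf.mul_le x y (γ - y) (γ - x) (by omega) (by omega) (by ring)
  rw [hsym, hsym] at this
  -- By symmetry the two products are `f x ^ 2` and `f y ^ 2`.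
  exact abs_le_of_sq_le_sq' (by simpa [sq] using this) (hf.nonneg y) |>.2

/-- Reflecting the weight in a sum against a symmetric sequence. -/
theorem sum_reflect (hF : ∀ z ∉ F, f z = 0) {γ : ℤ} (hsym : ∀ z, f (γ - z) = f z) (ψ : ℤ → ℝ) :
    ∑ z ∈ F, ψ (γ - z) * f z = ∑ z ∈ F, ψ z * f z := by
  have h : ∀ φ : ℤ → ℝ, ∑ z ∈ F, φ z * f z = ∑' z, φ z * f z := fun φ =>
    (tsum_eq_sum fun z hz => by rw [hF z hz, mul_zero]).symm
  rw [h, h, ← (Equiv.subLeft γ).tsum_eq fun z => ψ z * f z]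
  exact tsum_congr fun z => by rw [Equiv.subLeft_apply, hsym]

/-- A symmetric log-concave probability sequence of variance `V` is bounded by
`(1 + 2 V) ^ (-1 / 2)`. -/
theorem sq_mul_le_one_of_symmetric (hf : LogConcaveSeq f) (hF : ∀ z ∉ F, f z = 0)
    (h1 : ∑ z ∈ F, f z = 1) {γ : ℤ} (hsym : ∀ z, f (γ - z) = f z) (x : ℤ) :
    f x ^ 2 * (1 + 2 * (∑ z ∈ F, (z : ℝ) ^ 2 * f z - (∑ z ∈ F, (z : ℝ) * f z) ^ 2)) ≤ 1 := by
  have hVnn : 0 ≤ ∑ z ∈ F, (z : ℝ) ^ 2 * f z - (∑ z ∈ F, (z : ℝ) * f z) ^ 2 := by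
    have := Finset.sum_mul_sq_le_sq_mul_sq F (fun z => √(f z)) (fun z => z * √(f z))
    have e : ∀ z, √(f z) ^ 2 = f z := fun z => Real.sq_sqrt (hf.nonneg z)
    have e2 : ∀ z : ℤ, √(f z) * (z * √(f z)) = z * f z := fun z => by
      rw [mul_left_comm, Real.mul_self_sqrt (hf.nonneg z)]
    simp only [mul_pow, e, e2, h1] at this
    linarith
  have heven : ∀ {A B p V : ℝ}, p + A + B = 1 → A = B → V * p ^ 2 ≤ 1 - p - 2 * A * B →
      p ^ 2 * (1 + 2 * V) ≤ 1 := by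
    intro A B p V h0 hAB hV
    have hA : A = (1 - p) / 2 := by linarith
    subst hAB
    rw [hA] at hV
    nlinarith
  have tri : ∀ c, f c + ∑ z ∈ F with c < z, f z + ∑ z ∈ F with z < c, f z = 1 := fun c => by
    rw [← h1, sum_eq_add_sum_lt_add_sum_gt hF c]
  have le_of_max : ∀ c, f x ≤ f c →
      f c ^ 2 * (1 + 2 * (∑ z ∈ F, (z : ℝ) ^ 2 * f z - (∑ z ∈ F, (z : ℝ) * f z) ^ 2)) ≤ 1 →
      f x ^ 2 * (1 + 2 * (∑ z ∈ F, (z : ℝ) ^ 2 * f z - (∑ z ∈ F, (z : ℝ) * f z) ^ 2)) ≤ 1 := by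
    intro c hc h
    refine le_trans ?_ h
    have := hf.nonneg x
    gcongr
  obtain ⟨c, rfl | rfl⟩ := Int.even_or_odd' γ
  -- Integer centre: both sides have mass `(1 - p) / 2`, and the basic variance inequality becomes
  -- `V * p ^ 2 ≤ (1 - p ^ 2) / 2`.
  · refine le_of_max c (hf.le_of_abs_le hsym (by simp)) (heven (tri c) ?_
      (hf.variance_mul_sq_le hF h1 c))
    have := sum_reflect hF hsym fun z => if z < c then 1 else 0
    simp only [ite_mul, one_mul, zero_mul, ← Finset.sum_filter] at this
    rw [← this]
    exact Finset.sum_congr (Finset.filter_congr fun z _ => by omega) fun _ _ => rfl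
  -- Half-integer centre `c + 1/2`: the points from `c + 1` on carry mass 1/2, so the one-sided
  -- moment inequalities at `c + 1` control the whole variance.
  · refine le_of_max (c + 1) (hf.le_of_abs_le hsym ?_) ?_
    · rw [show 2 * (c + 1) - (2 * c + 1) = 1 by ring, abs_one]
      exact Int.one_le_abs (by omega)
    obtain ⟨hm1, hm2⟩ := hf.right_moments hF (c + 1)
    have split : ∀ φ : ℤ → ℝ, (∀ z, φ (2 * c + 1 - z) = φ z) →
        ∑ z ∈ F, φ z * f z = 2 * ∑ z ∈ F with c + 1 ≤ z, φ z * f z := by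
      intro φ hφ
      have h := sum_reflect hF hsym fun z => if c + 1 ≤ z then φ z else 0
      simp only [hφ, ite_mul, zero_mul, ← Finset.sum_filter] at h
      rw [two_mul]
      nth_rw 1 [← h]
      rw [Finset.sum_filter, Finset.sum_filter, ← Finset.sum_add_distrib]
      refine Finset.sum_congr rfl fun z _ => ?_
      by_cases hz : c + 1 ≤ z
      · simp [hz, show ¬ c + 1 ≤ 2 * c + 1 - z by omega]
      · simp [hz, show c + 1 ≤ 2 * c + 1 - z by omega]
    have t0 := split (fun _ => 1) fun _ => rfl
    have t2 := split (fun z => ((z : ℝ) - c - 1 / 2) ^ 2) fun z => by push_cast; ring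
    simp only [one_mul] at t0
    have hV : ∑ z ∈ F, (z : ℝ) ^ 2 * f z - (∑ z ∈ F, (z : ℝ) * f z) ^ 2 ≤
        ∑ z ∈ F, ((z : ℝ) - c - 1 / 2) ^ 2 * f z := by
      have e : ∑ z ∈ F, ((z : ℝ) - c - 1 / 2) ^ 2 * f z = ∑ z ∈ F, (z : ℝ) ^ 2 * f z -
          (2 * c + 1) * ∑ z ∈ F, (z : ℝ) * f z + (c + 1 / 2) ^ 2 * ∑ z ∈ F, f z := by
        rw [Finset.mul_sum, Finset.mul_sum, ← Finset.sum_sub_distrib, ← Finset.sum_add_distrib]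
        exact Finset.sum_congr rfl fun z _ => by ring
      rw [e, h1]
      nlinarith [sq_nonneg (∑ z ∈ F, (z : ℝ) * f z - (c + 1 / 2))]
    have e : ∑ z ∈ F with c + 1 ≤ z, ((z : ℝ) - c - 1 / 2) ^ 2 * f z =
        ∑ z ∈ F with c + 1 ≤ z, ((z : ℝ) - (c + 1 : ℤ)) ^ 2 * f z +
        ∑ z ∈ F with c + 1 ≤ z, ((z : ℝ) - (c + 1 : ℤ)) * f z +
        1 / 4 * ∑ z ∈ F with c + 1 ≤ z, f z := by
      rw [Finset.mul_sum, ← Finset.sum_add_distrib, ← Finset.sum_add_distrib]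
      exact Finset.sum_congr rfl fun z _ => by push_cast; ring
    rw [e] at t2
    rw [t2] at hV
    rw [h1] at t0
    have hS0 : ∑ z ∈ F with c + 1 ≤ z, f z = 1 / 2 := by linarith
    have hS1 : 0 ≤ ∑ z ∈ F with c + 1 ≤ z, ((z : ℝ) - (c + 1 : ℤ)) * f z :=
      Finset.sum_nonneg fun z hz =>
        mul_nonneg (sub_nonneg.2 (by exact_mod_cast (Finset.mem_filter.1 hz).2)) (hf.nonneg _)
    rw [hS0] at hm1 hm2 hV
    have hp := hf.nonneg (c + 1)
    have hp2 : f (c + 1) ≤ 1 / 2 := by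
      by_contra hcon
      nlinarith [mul_nonneg hp hS1]
    generalize f (c + 1) = p at *
    generalize (∑ z ∈ F with c + 1 ≤ z, ((z : ℝ) - (c + 1 : ℤ)) * f z) = S₁ at *
    generalize (∑ z ∈ F with c + 1 ≤ z, ((z : ℝ) - (c + 1 : ℤ)) ^ 2 * f z) = S₂ at *
    generalize (∑ z ∈ F, (z : ℝ) ^ 2 * f z - (∑ z ∈ F, (z : ℝ) * f z) ^ 2) = V at *
    have hV' : V ≤ 8 * S₁ ^ 2 + 4 * S₁ + 1 / 4 := by linarith
    have h3 : p * S₁ ≤ (1 - 2 * p) / 4 := by linarith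
    have h4 : (p * S₁) ^ 2 ≤ ((1 - 2 * p) / 4) ^ 2 := by
      have := mul_nonneg hp hS1
      gcongr
    have h5 : p ^ 2 * V ≤ 8 * (p * S₁) ^ 2 + 4 * p * (p * S₁) + p ^ 2 / 4 := by
      have := mul_le_mul_of_nonneg_left hV' (sq_nonneg p)
      linarith
    nlinarith [mul_le_mul_of_nonneg_left h3 hp]

end LogConcaveSeq

/-! ### Majorization by symmetric unimodal sequences. -/

/-- The embedding `t ↦ d + t` of `ℕ` into `ℤ`. -/
def intShift (d : ℤ) : ℕ ↪ ℤ where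
  toFun t := d + t
  inj' a b h := by simpa using h

@[simp] theorem intShift_apply (d : ℤ) (t : ℕ) : intShift d t = d + t := rfl

/-- `g` is a nonincreasing function of the distance to `γ / 2`. -/
def SymmetricUnimodal (γ : ℤ) (g : ℤ → ℝ) : Prop :=
  ∀ x y : ℤ, |2 * y - γ| ≤ |2 * x - γ| → g x ≤ g y

/-- The sum of `g` over any finite set is at most its sum over a centred interval of the same
size. -/
theorem SymmetricUnimodal.sum_le {γ : ℤ} {g : ℤ → ℝ} (hg : SymmetricUnimodal γ g) {n : ℕ} {d : ℤ}
    (hd : |2 * d + n - 1 - γ| ≤ 1) {D : Finset ℤ} (hD : D.card = n) :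
    ∑ x ∈ D, g x ≤ ∑ t ∈ Finset.range n, g (d + t) := by
  set I := (Finset.range n).map (intShift d) with hI
  have hsum : ∑ t ∈ Finset.range n, g (d + t) = ∑ x ∈ I, g x := by rw [hI, Finset.sum_map]; rfl
  have hmem : ∀ x, x ∈ I ↔ d ≤ x ∧ x < d + n := by
    intro x
    simp only [hI, Finset.mem_map, Finset.mem_range, intShift_apply]
    constructor
    · rintro ⟨t, ht, rfl⟩; omega
    · rintro ⟨h1, h2⟩; exact ⟨(x - d).toNat, by omega, by omega⟩
  have hcard : (D \ I).card = (I \ D).card := by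
    have h1 := Finset.card_sdiff_add_card_inter D I
    have h2 := Finset.card_sdiff_add_card_inter I D
    have h3 : I.card = n := by simp [hI]
    rw [Finset.inter_comm] at h2
    omega
  rw [hsum, ← Finset.sum_inter_add_sum_sdiff D I, ← Finset.sum_inter_add_sum_sdiff I D,
    Finset.inter_comm I D]
  -- Exchange argument: every point of `D` outside the interval is at least as far from `γ / 2` as
  -- every point of the interval missing from `D`, so any bijection between the two differences
  -- works.
  refine add_le_add le_rfl ?_
  rw [← Finset.sum_coe_sort, ← Finset.sum_coe_sort (I \ D),
    ← (Finset.equivOfCardEq hcard).sum_comp]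
  refine Finset.sum_le_sum fun x _ => hg _ _ ?_
  obtain ⟨x, hx⟩ := x
  obtain ⟨y, hy⟩ := Finset.equivOfCardEq hcard ⟨x, hx⟩
  have hx' := (Finset.mem_sdiff.1 hx).2
  have hy' := (Finset.mem_sdiff.1 hy).1
  rw [hmem] at hx' hy'
  rw [abs_le] at hd
  simp only
  rcases le_total 0 (2 * x - γ) with h1 | h1 <;> rcases le_total 0 (2 * y - γ) with h2 | h2 <;>
    simp only [abs_of_nonneg, abs_of_nonpos, h1, h2] <;> omega

/-- `f` is majorized by `g`: sums of `f` over finite sets are bounded by sums of `g` over finite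
sets of the same size. -/
def MajorizedBy (f : ℝ → ℝ) (g : ℤ → ℝ) : Prop :=
  ∀ C : Finset ℝ, ∃ D : Finset ℤ, D.card = C.card ∧ ∑ x ∈ C, f x ≤ ∑ x ∈ D, g x

/-- Peels a hook off the grid: along the row `i = 0`, then up the column `j = N`. Truncated
subtraction makes `t ↦ (t - N, min t N)` trace this path, and a grid smaller by one in each
direction remains. -/
theorem sum_grid_succ {M : Type*} [AddCommMonoid M] (φ : ℕ → ℕ → M) (l N : ℕ) :
    ∑ i ∈ Finset.range (l + 1), ∑ j ∈ Finset.range (N + 1), φ i j =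
      ∑ i ∈ Finset.range l, ∑ j ∈ Finset.range N, φ (i + 1) j +
      ∑ t ∈ Finset.range (N + 1 + l), φ (t - N) (min t N) := by
  rw [Finset.sum_range_succ', Finset.sum_range_add (fun t => φ (t - N) (min t N)) (N + 1) l]
  simp only [Finset.sum_range_succ _ N, Finset.sum_add_distrib]
  have h1 : ∑ x ∈ Finset.range N, φ (x - N) (min x N) = ∑ x ∈ Finset.range N, φ 0 x :=
    Finset.sum_congr rfl fun x hx => by
      have := Finset.mem_range.1 hx
      rw [Nat.sub_eq_zero_of_le this.le, min_eq_left this.le]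
  have h2 : ∑ x ∈ Finset.range l, φ (N + 1 + x - N) (min (N + 1 + x) N) =
      ∑ x ∈ Finset.range l, φ (x + 1) N :=
    Finset.sum_congr rfl fun x _ => by
      rw [min_eq_right (by omega), show N + 1 + x - N = x + 1 by omega]
  rw [h1, h2]
  simp only [Nat.sub_self, min_self]
  abel

/-- A grid which is strictly increasing in both directions carries at most as much of `f` as a
centred integer grid carries of `g`. -/
theorem MajorizedBy.sum_grid_le {f : ℝ → ℝ} {g : ℤ → ℝ} {γ : ℤ} (hfg : MajorizedBy f g)
    (hg : SymmetricUnimodal γ g) (l : ℕ) : ∀ (N : ℕ) (e : ℕ → ℕ → ℝ) (d : ℤ),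
      (∀ i i' j j', i ≤ i' → j ≤ j' → i + j < i' + j' → i' < l → j' < N → e i j < e i' j') →
      |2 * d + l + N - 2 - γ| ≤ 1 →
      ∑ i ∈ Finset.range l, ∑ j ∈ Finset.range N, f (e i j) ≤
        ∑ i ∈ Finset.range l, ∑ j ∈ Finset.range N, g (d + i + j) := by
  induction l with
  | zero => intro N e d _ _; simp
  | succ l ih =>
    intro N e d he hd
    rcases N with _ | N
    · simp
    rw [sum_grid_succ (fun i j => f (e i j)), sum_grid_succ (fun i j => g (d + (i : ℤ) + (j : ℤ)))]
    -- The inner grid has the same centre once `d` becomes `d + 1`. On the hook the real points are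
    -- distinct because `e` increases strictly, while the integer points are `N + 1 + l` consecutive
    -- values, so majorization and `SymmetricUnimodal.sum_le` compare the two.
    refine add_le_add ?_ ?_
    · have := ih N (fun i j => e (i + 1) j) (d + 1)
        (fun i i' j j' h1 h2 h3 h4 h5 => he _ _ _ _ (by omega) h2 (by omega) (by omega) (by omega))
        (by push_cast at hd; rwa [show 2 * (d + 1) + (l : ℤ) + N - 2 - γ =
          2 * d + ((l : ℤ) + 1) + (N + 1) - 2 - γ by ring])
      refine this.trans (le_of_eq (Finset.sum_congr rfl fun i _ => Finset.sum_congr rfl fun j _ => ?_))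
      congr 1
      push_cast; ring
    · have hmono : ∀ t t', t < t' → t' < N + 1 + l →
          e (t - N) (min t N) < e (t' - N) (min t' N) := fun t t' h1 h2 =>
        he _ _ _ _ (by omega) (by omega) (by omega) (by omega) (by omega)
      have hinj : Set.InjOn (fun t => e (t - N) (min t N)) (Finset.range (N + 1 + l)) := by
        intro t ht t' ht' h
        simp only [Finset.coe_range, Set.mem_Iio] at ht ht' h
        rcases lt_trichotomy t t' with h1 | h1 | h1
        · exact absurd h (hmono _ _ h1 ht').ne
        · exact h1
        · exact absurd h (hmono _ _ h1 ht).ne'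
      obtain ⟨D, hD, hle⟩ := hfg ((Finset.range (N + 1 + l)).image fun t => e (t - N) (min t N))
      rw [Finset.card_image_of_injOn hinj, Finset.card_range] at hD
      rw [Finset.sum_image hinj] at hle
      refine hle.trans ((hg.sum_le (d := d) ?_ hD).trans (le_of_eq ?_))
      · push_cast at hd ⊢
        rwa [show 2 * d + ((N : ℤ) + 1 + l) - 1 - γ = 2 * d + ((l : ℤ) + 1) + (N + 1) - 2 - γ by ring]
      · refine Finset.sum_congr rfl fun t _ => ?_
        congr 1
        omega

/-- A sum against a nonnegative weight is nonnegative as soon as it is so over all superlevel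
sets of the weight. -/
theorem sum_mul_nonneg_of_superlevel {ι : Type*} (F : Finset ι) (ψ : ι → ℝ) (n : ℕ) :
    ∀ k : ι → ℝ, (∀ j, 0 ≤ k j) → ({j ∈ F | 0 < k j} : Finset ι).card = n →
      (∀ t, 0 ≤ t → 0 ≤ ∑ j ∈ F with t < k j, ψ j) → 0 ≤ ∑ j ∈ F, k j * ψ j := by
  induction n using Nat.strong_induction_on with
  | _ n ih =>
    intro k hk hn hψ
    rcases ({j ∈ F | 0 < k j} : Finset ι).eq_empty_or_nonempty with h0 | h0
    · refine (Finset.sum_eq_zero fun j hj => ?_).ge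
      have : ¬ 0 < k j := fun h => by
        have : j ∈ ({j ∈ F | 0 < k j} : Finset ι) := Finset.mem_filter.2 ⟨hj, h⟩
        simp [h0] at this
      rw [le_antisymm (not_lt.1 this) (hk j), zero_mul]
    obtain ⟨i, hi, hmin⟩ := Finset.exists_min_image _ k h0
    have hi' := Finset.mem_filter.1 hi
    -- Layer-cake step: lowering the positive weights by their minimum `k i` removes at least one
    -- point from the support and splits off one superlevel sum.
    set k' : ι → ℝ := fun j => max (k j - k i) 0 with hk'
    have hlt : ∀ t j, 0 ≤ t → (t < k' j ↔ t + k i < k j) := by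
      intro t j ht
      rw [hk', lt_max_iff]
      constructor
      · rintro (h | h) <;> linarith
      · intro h; left; linarith
    have hsub : ({j ∈ F | 0 < k' j} : Finset ι) ⊂ ({j ∈ F | 0 < k j} : Finset ι) := by
      refine Finset.ssubset_iff_of_subset (fun j hj => ?_) |>.2 ⟨i, hi, fun h => ?_⟩
      · have h := Finset.mem_filter.1 hj
        rw [hlt 0 j le_rfl] at h
        exact Finset.mem_filter.2 ⟨h.1, by linarith [hk i]⟩
      · simp [hk'] at h
    have h1 := ih _ (hn ▸ Finset.card_lt_card hsub) k' (fun j => le_max_right _ _) rfl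
      (fun t ht => by
        have := hψ (t + k i) (add_nonneg ht (hk i))
        rwa [Finset.filter_congr fun j _ => hlt t j ht])
    have h2 := mul_nonneg (hk i) (hψ 0 le_rfl)
    have : ∑ j ∈ F, k j * ψ j = ∑ j ∈ F, k' j * ψ j + k i * ∑ j ∈ F with 0 < k j, ψ j := by
      rw [Finset.sum_filter, Finset.mul_sum, ← Finset.sum_add_distrib]
      refine Finset.sum_congr rfl fun j hj => ?_
      split_ifs with h
      · have := hmin j (Finset.mem_filter.2 ⟨hj, h⟩)
        rw [hk']
        simp only
        rw [max_eq_left (by linarith)]; ring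
      · have h0 : k j = 0 := le_antisymm (not_lt.1 h) (hk j)
        simp [hk', h0, hk i]
    rw [this]
    exact add_nonneg h1 h2

/-- A finite superlevel set of a symmetric unimodal sequence is a centred interval. -/
theorem SymmetricUnimodal.exists_superlevel_eq {γ : ℤ} {k : ℤ → ℝ} (hk : SymmetricUnimodal γ k)
    {F : Finset ℤ} {t : ℝ} (hF : ∀ j, t < k j → j ∈ F) :
    ∃ (u : ℤ) (N : ℕ), (N ≠ 0 → 2 * u + N - 1 = γ) ∧
      ∀ ψ : ℤ → ℝ, ∑ j ∈ F with t < k j, ψ j = ∑ i ∈ Finset.range N, ψ (u + i) := by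
  rcases ({j ∈ F | t < k j} : Finset ℤ).eq_empty_or_nonempty with h0 | h0
  · exact ⟨0, 0, by simp, fun ψ => by rw [h0]; simp⟩
  obtain ⟨u, hu, hmin⟩ := Finset.exists_min_image _ id h0
  have hmem : ∀ j, j ∈ ({j ∈ F | t < k j} : Finset ℤ) ↔ t < k j := fun j =>
    ⟨fun h => (Finset.mem_filter.1 h).2, fun h => Finset.mem_filter.2 ⟨hF j h, h⟩⟩
  have hku := (hmem u).1 hu
  have hup : ∀ y, |2 * y - γ| ≤ |2 * u - γ| → t < k y := fun y hy => hku.trans_le (hk u y hy)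
  have huγ : 2 * u ≤ γ := by
    have h1 := hup (γ - u) (by
      rw [show 2 * (γ - u) - γ = -(2 * u - γ) by ring, abs_neg])
    have := hmin (γ - u) ((hmem _).2 h1)
    simp only [id] at this
    omega
  have hiff : ∀ y, t < k y ↔ u ≤ y ∧ y ≤ γ - u := by
    intro y
    constructor
    · intro hy
      refine ⟨hmin y ((hmem y).2 hy), ?_⟩
      have h1 : t < k (γ - y) := hy.trans_le (hk y (γ - y) (by
        rw [show 2 * (γ - y) - γ = -(2 * y - γ) by ring, abs_neg]))
      have := hmin (γ - y) ((hmem _).2 h1)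
      simp only [id] at this
      omega
    · rintro ⟨h1, h2⟩
      refine hup y ?_
      rw [abs_of_nonpos (show 2 * u - γ ≤ 0 by omega), abs_le]
      constructor <;> omega
  refine ⟨u, (γ - 2 * u + 1).toNat, fun _ => by omega, fun ψ => ?_⟩
  symm
  refine Finset.sum_of_injOn (fun i : ℕ => u + (i : ℤ)) (fun a _ b _ h => by simpa using h) ?_ ?_
    fun _ _ => rfl
  · intro i hi
    simp only [Finset.coe_range, Set.mem_Iio] at hi
    exact (hmem _).2 ((hiff _).2 ⟨by dsimp only; omega, by dsimp only; omega⟩)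
  · intro y hy hy'
    have := (hiff y).1 ((hmem y).1 hy)
    exact absurd ⟨(y - u).toNat, by simp; omega, by simp; omega⟩ hy'

/-- Majorization is preserved by convolving with a symmetric unimodal sequence, dilated by a
nonzero factor on the real side. -/
theorem MajorizedBy.conv {f : ℝ → ℝ} {g : ℤ → ℝ} {γ γ' : ℤ} (hfg : MajorizedBy f g)
    (hg : SymmetricUnimodal γ g) {k : ℤ → ℝ} (hk0 : ∀ j, 0 ≤ k j) (hk : SymmetricUnimodal γ' k)
    {F : Finset ℤ} (hF : ∀ j ∉ F, k j = 0) {a : ℝ} (ha : a ≠ 0) :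
    MajorizedBy (fun x => ∑ j ∈ F, k j * f (x - a * j)) (fun x => ∑ j ∈ F, k j * g (x - j)) := by
  intro C
  set l := C.card with hl
  -- The comparison set is an interval of length `l` centred within 1/2 of `(γ + γ') / 2`. It does
  -- not depend on the superlevel, so each superlevel of `k` can be treated separately.
  obtain ⟨w, hw⟩ : ∃ w : ℤ, |2 * w + l - 1 - γ' - γ| ≤ 1 :=
    ⟨(γ' + γ + 1 - l) / 2, by rw [abs_le]; omega⟩
  refine ⟨(Finset.range l).map (intShift w), by simp [hl], ?_⟩
  rw [Finset.sum_map, Finset.sum_comm, Finset.sum_comm (s := Finset.range l)]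
  simp only [← Finset.mul_sum, intShift_apply]
  rw [← sub_nonneg, ← Finset.sum_sub_distrib]
  simp only [← mul_sub]
  refine sum_mul_nonneg_of_superlevel F _ _ k hk0 rfl fun t ht => ?_
  obtain ⟨u, N, huN, hsum⟩ := hk.exists_superlevel_eq (F := F) (t := t) fun j hj => by
    by_contra h
    rw [hF j h] at hj
    exact absurd hj (not_lt.2 ht)
  rw [hsum, Finset.sum_sub_distrib, sub_nonneg]
  rcases Nat.eq_zero_or_pos N with rfl | hN
  · simp
  have huN' := huN hN.ne'
  set c : ℕ → ℝ := fun i => if h : i < l then C.orderEmbOfFin hl.symm ⟨i, h⟩ else 0 with hc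
  have hcsum : ∀ φ : ℝ → ℝ, ∑ x ∈ C, φ x = ∑ i ∈ Finset.range l, φ (c i) := by
    intro φ
    rw [Finset.sum_range, ← Finset.sum_coe_sort,
      ← (C.orderIsoOfFin hl.symm).toEquiv.sum_comp]
    refine Finset.sum_congr rfl fun i _ => ?_
    simp [hc]
  have hcmono : ∀ i i', i < i' → i' < l → c i < c i' := by
    intro i i' h1 h2
    simp only [hc, h2, h1.trans h2, dif_pos]
    exact (C.orderEmbOfFin hl.symm).strictMono h1
  -- With `C` sorted, the points `x - a * (u + j)` form a grid increasing in both indices. For `a >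
  -- 0` the index `j` must be reversed, which changes the offset.
  have hgrid := hfg.sum_grid_le hg l N
    (fun i j => c i + |a| * j - (if 0 < a then a * (u + N - 1) else a * u)) (w - u - N + 1)
    (fun i i' j j' h1 h2 h3 h4 h5 => by
      have ha' : 0 < |a| := abs_pos.2 ha
      have hj : (j : ℝ) ≤ j' := by exact_mod_cast h2
      rcases h1.eq_or_lt with rfl | h1
      · have hj : (j : ℝ) < j' := by exact_mod_cast (show j < j' by omega)
        have := mul_lt_mul_of_pos_left hj ha'
        linarith
      · have := hcmono i i' h1 h4
        have := mul_le_mul_of_nonneg_left hj ha'.le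
        linarith)
    (by
      rwa [show 2 * (w - u - N + 1) + (l : ℤ) + N - 2 - γ =
        2 * w + l - 1 - γ' - γ by rw [← huN']; ring])
  rw [Finset.sum_comm (s := Finset.range l), Finset.sum_comm (s := Finset.range l)] at hgrid
  have hL : ∑ j ∈ Finset.range N, ∑ x ∈ C, f (x - a * ((u + (j : ℤ) : ℤ) : ℝ)) =
      ∑ j ∈ Finset.range N, ∑ i ∈ Finset.range l,
        f (c i + |a| * j - (if 0 < a then a * (u + N - 1) else a * u)) := by
    simp only [hcsum]
    split_ifs with hpos
    · rw [← Finset.sum_range_reflect]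
      refine Finset.sum_congr rfl fun j hj => Finset.sum_congr rfl fun i _ => ?_
      have := Finset.mem_range.1 hj
      congr 1
      rw [abs_of_pos hpos]
      push_cast [Nat.cast_sub (show j ≤ N - 1 by omega), Nat.cast_sub (show 1 ≤ N by omega)]
      ring
    · refine Finset.sum_congr rfl fun j hj => Finset.sum_congr rfl fun i _ => ?_
      congr 1
      rw [abs_of_nonpos (not_lt.1 hpos)]
      push_cast
      ring
  have hR : ∑ j ∈ Finset.range N, ∑ i ∈ Finset.range l, g (w + (i : ℤ) - (u + (j : ℤ))) =
      ∑ j ∈ Finset.range N, ∑ i ∈ Finset.range l, g (w - u - N + 1 + (i : ℤ) + (j : ℤ)) := by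
    rw [← Finset.sum_range_reflect]
    refine Finset.sum_congr rfl fun j hj => Finset.sum_congr rfl fun i _ => ?_
    have := Finset.mem_range.1 hj
    congr 1
    omega
  rw [hL, hR]
  exact hgrid

/-! ### Averaging a log-concave sequence against a bounded weight. -/

/-- Telescoping along the cumulative sums of a weight on a finite set of integers. -/
theorem sum_cumulative_sub (F : Finset ℤ) (Φ : ℝ → ℝ) (v : ℤ → ℝ) :
    ∑ x ∈ F, (Φ (∑ z ∈ F with z < x, v z + v x) - Φ (∑ z ∈ F with z < x, v z)) =
      Φ (∑ z ∈ F, v z) - Φ 0 := by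
  induction F using Finset.induction_on_max with
  | empty => simp
  | insert a s ha ih =>
    have has : a ∉ s := fun h => lt_irrefl _ (ha a h)
    rw [Finset.sum_insert has, Finset.sum_insert has]
    have h1 : ({z ∈ insert a s | z < a} : Finset ℤ) = s := by
      ext z
      simp only [Finset.mem_filter, Finset.mem_insert]
      exact ⟨fun ⟨h, h'⟩ => h.resolve_left h'.ne, fun h => ⟨Or.inr h, ha z h⟩⟩
    have h2 : ∀ x ∈ s, ({z ∈ insert a s | z < x} : Finset ℤ) = {z ∈ s | z < x} := by
      intro x hx
      rw [Finset.filter_insert, if_neg (ha x hx).not_gt]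
    have h3 : ∑ x ∈ s, (Φ (∑ z ∈ insert a s with z < x, v z + v x) -
        Φ (∑ z ∈ insert a s with z < x, v z)) = Φ (∑ z ∈ s, v z) - Φ 0 := by
      rw [← ih]
      exact Finset.sum_congr rfl fun x hx => by rw [h2 x hx]
    rw [h1, h3, add_comm (v a)]
    ring

/-- The mean of `s * (1 - s)` over an interval of length `p`, where `B` lies to its left and `A`
to its right. -/
noncomputable def atomMean (A B p : ℝ) : ℝ := A * B + p * (A + B) / 2 + p ^ 2 / 6

/-- `atomMean` divided by the total of its three masses is nondecreasing in each of them: after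
clearing denominators the difference expands in the increments `a`, `b`, `c` with nonnegative
coefficients. -/
theorem atomMean_le_mul {A B p A' B' w : ℝ} (hA' : 0 ≤ A') (hB' : 0 ≤ B') (hw : 0 ≤ w)
    (hA : A' ≤ A) (hB : B' ≤ B) (hp : w ≤ p) (h1 : p + A + B = 1) :
    atomMean A' B' w ≤ (A' + B' + w) * atomMean A B p := by
  obtain ⟨a, ha, rfl⟩ : ∃ a, 0 ≤ a ∧ A = A' + a := ⟨A - A', by linarith, by ring⟩
  obtain ⟨b, hb, rfl⟩ : ∃ b, 0 ≤ b ∧ B = B' + b := ⟨B - B', by linarith, by ring⟩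
  obtain ⟨c, hc, rfl⟩ : ∃ c, 0 ≤ c ∧ p = w + c := ⟨p - w, by linarith, by ring⟩
  have key : (A' + B' + w) * atomMean (A' + a) (B' + b) (w + c) -
      (w + c + (A' + a) + (B' + b)) * atomMean A' B' w =
      a * (B' * (B' + w / 2) + w * B' / 2 + w ^ 2 / 3) + b * (A' * (A' + w / 2) + w * A' / 2 +
        w ^ 2 / 3) + c * ((A' ^ 2 + B' ^ 2) / 2 + w * (A' + B') / 3 + w ^ 2 / 6) +
      (A' + B' + w) * (a * b + c * (a + b) / 2 + c ^ 2 / 6) := by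
    simp only [atomMean]; ring
  rw [h1, one_mul] at key
  have : 0 ≤ a * (B' * (B' + w / 2) + w * B' / 2 + w ^ 2 / 3) + b * (A' * (A' + w / 2) + w * A' / 2 +
        w ^ 2 / 3) + c * ((A' ^ 2 + B' ^ 2) / 2 + w * (A' + B') / 3 + w ^ 2 / 6) +
      (A' + B' + w) * (a * b + c * (a + b) / 2 + c ^ 2 / 6) := by positivity
  linarith

/-- Each term is the integral of `s * (P - s)` over the interval that the atom occupies, and these
intervals tile `[0, P]`. -/
theorem sum_mul_atomMean (F : Finset ℤ) (w : ℤ → ℝ) (hw : ∀ z ∉ F, w z = 0) :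
    ∑ x ∈ F, w x * atomMean (∑ z ∈ F with x < z, w z) (∑ z ∈ F with z < x, w z) (w x) =
      (∑ z ∈ F, w z) ^ 3 / 6 := by
  set P := ∑ z ∈ F, w z with hP
  have h := sum_cumulative_sub F (fun t => P * t ^ 2 / 2 - t ^ 3 / 3) w
  rw [← hP] at h
  have : P * P ^ 2 / 2 - P ^ 3 / 3 - (P * 0 ^ 2 / 2 - 0 ^ 3 / 3) = P ^ 3 / 6 := by ring
  rw [← this, ← h]
  refine Finset.sum_congr rfl fun x _ => ?_
  have : ∑ z ∈ F with x < z, w z = P - ∑ z ∈ F with z < x, w z - w x := by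
    rw [hP, sum_eq_add_sum_lt_add_sum_gt hw x]; ring
  rw [this, atomMean]
  ring

/-- If the conclusion failed, squaring `h` would give `σ ^ 2 * m * S < 3 * m ^ 2 - 2`. Combined with
the negated conclusion this contradicts `hpoly`, which holds because `σ ^ 2` is at least `8 / 3 + 13
* (m ^ 2 - 1)`. -/
theorem sq_mul_le_one_of_mul_le {V m S σ : ℝ} (hσ : σ ^ 2 = V + 2 / 3) (hσ0 : 0 ≤ σ) (hm : 1 ≤ m)
    (hS : 0 ≤ S) (hV : 2 + 13 * (m ^ 2 - 1) ≤ V) (h : σ * S + σ * m * S ^ 2 / 6 ≤ 1) :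
    S ^ 2 * (V + m ^ 2) ≤ 1 := by
  by_contra! hcon
  have hS0 : 0 < S := by
    rcases hS.eq_or_lt with rfl | h
    · norm_num at hcon
    · exact h
  have h2 : σ ^ 2 * S ^ 2 * (1 + m * S / 3) ≤ 1 := by
    have : (σ * S + σ * m * S ^ 2 / 6) ^ 2 ≤ 1 := by
      apply pow_le_one₀ _ h
      positivity
    have : 0 ≤ (σ * m * S ^ 2 / 6) ^ 2 := by positivity
    nlinarith
  have h3 : σ ^ 2 * m * S < 3 * m ^ 2 - 2 := by
    have : S ^ 2 * (σ ^ 2 * m * S) < S ^ 2 * (3 * m ^ 2 - 2) := by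
      nlinarith
    exact lt_of_mul_lt_mul_left this (by positivity)
  have h4 : (σ ^ 2 * m * S) ^ 2 < (3 * m ^ 2 - 2) ^ 2 := by
    have : 0 ≤ σ ^ 2 * m * S := by positivity
    gcongr
  have h5 : 1 < S ^ 2 * (σ ^ 2 + m ^ 2) := by
    have : 0 < S ^ 2 := by positivity
    nlinarith
  obtain ⟨t, ht, hmt⟩ : ∃ t, 0 ≤ t ∧ m ^ 2 = 1 + t := ⟨m ^ 2 - 1, by nlinarith, by ring⟩
  obtain ⟨e, he, hse⟩ : ∃ e, 0 ≤ e ∧ σ ^ 2 = 8 / 3 + 13 * t + e :=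
    ⟨σ ^ 2 - (8 / 3 + 13 * t), by rw [hσ]; linarith, by ring⟩
  have hpoly : (3 * m ^ 2 - 2) ^ 2 * (σ ^ 2 + m ^ 2) ≤ (σ ^ 2) ^ 2 * m ^ 2 := by
    rw [hmt, hse, ← sub_nonneg]
    have : (8 / 3 + 13 * t + e) ^ 2 * (1 + t) - (3 * (1 + t) - 2) ^ 2 * (8 / 3 + 13 * t + e + (1 + t))
      = e ^ 2 * (1 + t) + e * (13 / 3 + 76 / 3 * t + 17 * t ^ 2) +
        (31 / 9 + 364 / 9 * t + 364 / 3 * t ^ 2 + 43 * t ^ 3) := by ring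
    rw [this]
    positivity
  have h6 : (σ ^ 2) ^ 2 * m ^ 2 < (σ ^ 2 * m * S) ^ 2 * (σ ^ 2 + m ^ 2) := by
    have : 0 < (σ ^ 2) ^ 2 * m ^ 2 := by
      have : 0 < σ ^ 2 := by rw [hse]; positivity
      positivity
    calc (σ ^ 2) ^ 2 * m ^ 2 = (σ ^ 2) ^ 2 * m ^ 2 * 1 := by ring
      _ < (σ ^ 2) ^ 2 * m ^ 2 * (S ^ 2 * (σ ^ 2 + m ^ 2)) := by gcongr
      _ = _ := by ring
  have h7 : (σ ^ 2 * m * S) ^ 2 * (σ ^ 2 + m ^ 2) ≤ (3 * m ^ 2 - 2) ^ 2 * (σ ^ 2 + m ^ 2) := by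
    gcongr
  linarith

/-- Averaging a log-concave probability sequence of large variance `V` against a weight bounded by
`1 / m`. -/
theorem LogConcaveSeq.sum_mul_sq_le {f : ℤ → ℝ} {F : Finset ℤ} (hf : LogConcaveSeq f)
    (hF : ∀ z ∉ F, f z = 0) (h1 : ∑ z ∈ F, f z = 1) {R : ℤ → ℝ} {m V : ℝ}
    (hVdef : V = ∑ z ∈ F, (z : ℝ) ^ 2 * f z - (∑ z ∈ F, (z : ℝ) * f z) ^ 2)
    (hR0 : ∀ z, 0 ≤ R z) (hRm : ∀ z, m * R z ≤ 1) (hR1 : ∑ z ∈ F, R z ≤ 1) (hm : 1 ≤ m)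
    (hV : 2 + 13 * (m ^ 2 - 1) ≤ V) :
    (∑ z ∈ F, R z * f z) ^ 2 * (V + m ^ 2) ≤ 1 := by
  have hm2 : 0 ≤ m ^ 2 - 1 := by nlinarith
  set σ := √(V + 2 / 3) with hσdef
  have hσ0 : 0 ≤ σ := Real.sqrt_nonneg _
  have hσ : σ ^ 2 = V + 2 / 3 := Real.sq_sqrt (by linarith)
  set A : ℤ → ℝ := fun x => ∑ z ∈ F with x < z, f z with hA
  set B : ℤ → ℝ := fun x => ∑ z ∈ F with z < x, f z with hB
  have hA0 : ∀ x, 0 ≤ A x := fun x => Finset.sum_nonneg fun _ _ => hf.nonneg _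
  have hB0 : ∀ x, 0 ≤ B x := fun x => Finset.sum_nonneg fun _ _ => hf.nonneg _
  have htri : ∀ x, f x + A x + B x = 1 := fun x => by rw [← h1, sum_eq_add_sum_lt_add_sum_gt hF x]
  have hq0 : ∀ x, 0 ≤ atomMean (A x) (B x) (f x) := fun x => by
    have := hA0 x; have := hB0 x; have := hf.nonneg x
    rw [atomMean]; positivity
  -- With `q` the `atomMean`, the variance inequality reads `(V + 2/3) * f x ^ 2 ≤ 1 - 2 * q`, which
  -- explains the `2 / 3` in `σ`; and `1 - 2 * q ≤ (1 - q) ^ 2`.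
  have hstar : ∀ x, σ * f x + atomMean (A x) (B x) (f x) ≤ 1 := by
    intro x
    have h := hf.variance_mul_sq_le hF h1 x
    rw [← hVdef] at h
    change V * f x ^ 2 ≤ 1 - f x - 2 * A x * B x at h
    have ht := htri x
    have hAB : A x + B x = 1 - f x := by linarith
    have e : 2 * atomMean (A x) (B x) (f x) = 2 * A x * B x + f x * (1 - f x) + f x ^ 2 / 3 := by
      rw [atomMean, hAB]; ring
    have hsq : (σ * f x) ^ 2 ≤ 1 - 2 * atomMean (A x) (B x) (f x) := by
      rw [mul_pow, hσ, e]; linarith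
    have hle : atomMean (A x) (B x) (f x) ≤ 1 := by nlinarith [sq_nonneg (σ * f x)]
    have := abs_le_of_sq_le_sq' (a := σ * f x) (b := 1 - atomMean (A x) (B x) (f x))
      (by nlinarith [sq_nonneg (atomMean (A x) (B x) (f x))]) (by linarith)
    linarith [this.2]
  have hσf : ∀ x, σ * f x ≤ 1 := fun x => by linarith [hstar x, hq0 x]
  set S := ∑ z ∈ F, R z * f z with hS
  have hS0 : 0 ≤ S := Finset.sum_nonneg fun z _ => mul_nonneg (hR0 z) (hf.nonneg z)
  refine sq_mul_le_one_of_mul_le hσ hσ0 hm hS0 hV ?_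
  rcases hS0.eq_or_lt with hS00 | hSpos
  · rw [← hS00]; norm_num
  -- `w` lies below `f` and has total mass `m * S`. Comparing its `atomMean` with that of `f` bounds
  -- from below the term that `hstar` gains when averaged against `R`.
  set w : ℤ → ℝ := fun z => m * (R z * f z) with hw
  have hw0 : ∀ z, 0 ≤ w z := fun z => by
    have := hR0 z; have := hf.nonneg z
    simp only [hw]; positivity
  have hwf : ∀ z, w z ≤ f z := fun z => by
    simp only [hw]
    nlinarith [mul_le_mul_of_nonneg_right (hRm z) (hf.nonneg z)]
  have hP : ∑ z ∈ F, w z = m * S := by rw [hS, Finset.mul_sum]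
  have hcube := sum_mul_atomMean F w fun z hz => by simp [hw, hF z hz]
  rw [hP] at hcube
  have hwq : (m * S) ^ 3 / 6 ≤ m * S * ∑ x ∈ F, w x * atomMean (A x) (B x) (f x) := by
    rw [← hcube, Finset.mul_sum]
    refine Finset.sum_le_sum fun x _ => ?_
    have h := atomMean_le_mul (A := A x) (B := B x) (p := f x)
      (A' := ∑ z ∈ F with x < z, w z) (B' := ∑ z ∈ F with z < x, w z) (w := w x)
      (Finset.sum_nonneg fun _ _ => hw0 _) (Finset.sum_nonneg fun _ _ => hw0 _) (hw0 x)
      (Finset.sum_le_sum fun _ _ => hwf _) (Finset.sum_le_sum fun _ _ => hwf _) (hwf x) (htri x)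
    have hsum : ∑ z ∈ F with x < z, w z + ∑ z ∈ F with z < x, w z + w x = m * S := by
      rw [← hP, sum_eq_add_sum_lt_add_sum_gt (F := F) (f := w) (fun z hz => by simp [hw, hF z hz]) x]; ring
    rw [hsum] at h
    calc _ ≤ w x * (m * S * atomMean (A x) (B x) (f x)) := mul_le_mul_of_nonneg_left h (hw0 x)
      _ = _ := by ring
  have hmS : 0 < m * S := by positivity
  have hwq' : (m * S) ^ 2 / 6 ≤ ∑ x ∈ F, w x * atomMean (A x) (B x) (f x) := by
    refine le_of_mul_le_mul_left ?_ hmS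
    calc m * S * ((m * S) ^ 2 / 6) = (m * S) ^ 3 / 6 := by ring
      _ ≤ _ := hwq
  have hRq : σ * ∑ x ∈ F, w x * atomMean (A x) (B x) (f x) ≤
      m * ∑ x ∈ F, R x * atomMean (A x) (B x) (f x) := by
    rw [Finset.mul_sum, Finset.mul_sum]
    refine Finset.sum_le_sum fun x _ => ?_
    have h0 : 0 ≤ m * R x * atomMean (A x) (B x) (f x) := by
      have := hR0 x; have := hq0 x; positivity
    calc σ * (w x * atomMean (A x) (B x) (f x)) =
        (m * R x * atomMean (A x) (B x) (f x)) * (σ * f x) := by simp only [hw]; ring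
      _ ≤ (m * R x * atomMean (A x) (B x) (f x)) * 1 := mul_le_mul_of_nonneg_left (hσf x) h0
      _ = _ := by ring
  have htotal : σ * S + ∑ x ∈ F, R x * atomMean (A x) (B x) (f x) ≤ 1 := by
    refine le_trans ?_ hR1
    rw [hS, Finset.mul_sum, ← Finset.sum_add_distrib]
    refine Finset.sum_le_sum fun x _ => ?_
    nlinarith [mul_le_mul_of_nonneg_left (hstar x) (hR0 x)]
  have : m * (σ * m * S ^ 2 / 6) ≤ m * ∑ x ∈ F, R x * atomMean (A x) (B x) (f x) := by
    refine le_trans (le_of_eq ?_) ((mul_le_mul_of_nonneg_left hwq' hσ0).trans hRq)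
    ring
  have := le_of_mul_le_mul_left this (by linarith)
  linarith

/-! ### Mass functions, convolution and variance of finitely valued variables. -/

theorem massFunction_nonneg {Ω E : Type*} [MeasurableSpace Ω] {μ : Measure Ω} (X : Ω → E) (x : E) :
    0 ≤ massFunction μ X x :=
  measureReal_nonneg

theorem massFunction_eq_zero {Ω E : Type*} [MeasurableSpace Ω] {μ : Measure Ω} {X : Ω → E}
    {Q : Finset E} (hQ : ∀ᵐ ω ∂μ, X ω ∈ Q) {x : E} (hx : x ∉ Q) :
    massFunction μ X x = 0 := by
  have : μ (X ⁻¹' {x}) = 0 := by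
    refine measure_mono_null (fun ω hω => ?_) (ae_iff.1 hQ)
    rw [Set.mem_preimage, Set.mem_singleton_iff] at hω
    simpa [hω] using hx
  rw [massFunction, measureReal_def, this, ENNReal.toReal_zero]

section Discrete

variable {Ω E : Type*} [MeasurableSpace Ω] {μ : Measure Ω} [MeasurableSpace E]
  [MeasurableSingletonClass E] {X : Ω → E} {Q : Finset E}

theorem measureReal_eq_sum_inter_preimage [IsFiniteMeasure μ] (hX : Measurable X)
    (hQ : ∀ᵐ ω ∂μ, X ω ∈ Q) {A : Set Ω} (hA : MeasurableSet A) :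
    μ.real A = ∑ y ∈ Q, μ.real (X ⁻¹' {y} ∩ A) := by
  rw [← measureReal_biUnion_finset]
  · refine measureReal_congr ?_
    filter_upwards [hQ] with ω hω
    refine propext ⟨fun h => ?_, fun h => ?_⟩
    · exact Set.mem_iUnion₂.2 ⟨X ω, hω, rfl, h⟩
    · obtain ⟨y, _, _, h⟩ := Set.mem_iUnion₂.1 h
      exact h
  · intro y _ z _ hyz
    refine Set.disjoint_left.2 fun ω h1 h2 => hyz ?_
    exact (h1.1 : X ω = y).symm.trans h2.1
  · exact fun y _ => (hX (measurableSet_singleton y)).inter hA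

theorem sum_massFunction [IsProbabilityMeasure μ] (hX : Measurable X) (hQ : ∀ᵐ ω ∂μ, X ω ∈ Q) :
    ∑ y ∈ Q, massFunction μ X y = 1 := by
  have := measureReal_eq_sum_inter_preimage hX hQ MeasurableSet.univ
  simp only [Set.inter_univ, probReal_univ] at this
  exact this.symm

theorem massFunction_add [IsProbabilityMeasure μ] [AddCommGroup E] {Y : Ω → E} (hX : Measurable X)
    (hXY : IndepFun X Y μ) (hQ : ∀ᵐ ω ∂μ, X ω ∈ Q)
    (hadd : Measurable fun ω => X ω + Y ω) (x : E) :
    massFunction μ (fun ω => X ω + Y ω) x =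
      ∑ y ∈ Q, massFunction μ X y * massFunction μ Y (x - y) := by
  rw [massFunction, measureReal_eq_sum_inter_preimage hX hQ (hadd (measurableSet_singleton x))]
  refine Finset.sum_congr rfl fun y _ => ?_
  have : X ⁻¹' {y} ∩ (fun ω => X ω + Y ω) ⁻¹' {x} = X ⁻¹' {y} ∩ Y ⁻¹' {x - y} := by
    ext ω
    simp only [Set.mem_inter_iff, Set.mem_preimage, Set.mem_singleton_iff]
    refine and_congr_right fun h => ?_
    rw [h, eq_sub_iff_add_eq']
  rw [this, massFunction, massFunction, measureReal_def, hXY.measure_inter_preimage_eq_mul _ _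
    (measurableSet_singleton _) (measurableSet_singleton _), ENNReal.toReal_mul]
  rfl

theorem integral_comp_eq_sum [IsProbabilityMeasure μ] (hX : Measurable X)
    (hQ : ∀ᵐ ω ∂μ, X ω ∈ Q) (φ : E → ℝ) :
    ∫ ω, φ (X ω) ∂μ = ∑ y ∈ Q, φ y * massFunction μ X y := by
  have : (fun ω => φ (X ω)) =ᵐ[μ]
      fun ω => ∑ y ∈ Q, (X ⁻¹' {y}).indicator (fun _ => φ y) ω := by
    filter_upwards [hQ] with ω hω
    rw [Finset.sum_eq_single (X ω)]
    · simp
    · intro y _ hy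
      exact Set.indicator_of_notMem (fun h => hy (h : X ω = y).symm) _
    · exact fun h => absurd hω h
  rw [integral_congr_ae this, integral_finsetSum]
  · refine Finset.sum_congr rfl fun y _ => ?_
    rw [integral_indicator_const _ (hX (measurableSet_singleton y)), smul_eq_mul, mul_comm]
    rfl
  · exact fun y _ => (integrable_const _).indicator (hX (measurableSet_singleton y))

end Discrete

section Integer

variable {Ω : Type*} [MeasurableSpace Ω] {μ : Measure Ω} {X : Ω → ℤ} {Q : Finset ℤ}

theorem FinitelySupported.ae_mem [IsFiniteMeasure μ] (h : FinitelySupported μ X) :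
    ∀ᵐ ω ∂μ, X ω ∈ h.toFinset := by
  have : ∀ j : ℤ, ∀ᵐ ω ∂μ, X ω = j → j ∈ h.toFinset := by
    intro j
    by_cases hj : j ∈ h.toFinset
    · exact Filter.Eventually.of_forall fun _ _ => hj
    · have h0 : massFunction μ X j = 0 := by
        exact Function.notMem_support.1 fun h' => hj ((Set.Finite.mem_toFinset h).2 h')
      rw [massFunction, measureReal_eq_zero_iff] at h0
      rw [ae_iff]
      refine measure_mono_null (fun ω hω => ?_) h0
      simp only [Classical.not_imp, Set.mem_ofPred_eq] at hω
      exact hω.1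
  filter_upwards [ae_all_iff.2 this] with ω hω
  exact hω _ rfl

theorem memLp_intCast [IsProbabilityMeasure μ] (hX : Measurable X) (hQ : ∀ᵐ ω ∂μ, X ω ∈ Q) :
    MemLp (fun ω => (X ω : ℝ)) 2 μ := by
  refine MemLp.of_bound (C := ∑ z ∈ Q, |(z : ℝ)|)
    (measurable_from_top.comp hX : Measurable fun ω => ((X ω : ℤ) : ℝ)).aestronglyMeasurable ?_
  filter_upwards [hQ] with ω hω
  exact Finset.single_le_sum (f := fun z : ℤ => |(z : ℝ)|) (fun _ _ => abs_nonneg _) hω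

theorem variance_eq_sum [IsProbabilityMeasure μ] (hX : Measurable X) (hQ : ∀ᵐ ω ∂μ, X ω ∈ Q) :
    variance (fun ω => (X ω : ℝ)) μ = ∑ z ∈ Q, (z : ℝ) ^ 2 * massFunction μ X z -
      (∑ z ∈ Q, (z : ℝ) * massFunction μ X z) ^ 2 := by
  rw [variance_eq_sub (memLp_intCast hX hQ), ← integral_comp_eq_sum hX hQ fun z : ℤ => (z : ℝ) ^ 2,
    ← integral_comp_eq_sum hX hQ fun z : ℤ => (z : ℝ)]
  rfl

end Integer

section Sums

variable {Ω E ι : Type*} [MeasurableSpace Ω] {μ : Measure Ω} [MeasurableSpace E] [AddCommGroup E]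
  [MeasurableAdd₂ E] {X : ι → Ω → ℤ}

theorem measurable_sum_comp (hX : ∀ k, Measurable (X k)) (φ : ι → ℤ → E) (s : Finset ι) :
    Measurable fun ω => ∑ k ∈ s, φ k (X k ω) :=
  Finset.measurable_sum _ fun k _ => (measurable_from_top (f := φ k)).comp (hX k)

theorem indepFun_sum_comp_of_disjoint (hX : ∀ k, Measurable (X k)) (hind : iIndepFun X μ)
    (φ : ι → ℤ → E) {s t : Finset ι} (hst : Disjoint s t) :
    IndepFun (fun ω => ∑ k ∈ s, φ k (X k ω)) (fun ω => ∑ k ∈ t, φ k (X k ω)) μ := by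
  have hm : ∀ u : Finset ι, Measurable fun v : u → ℤ => ∑ k : u, φ k (v k) := fun u =>
    Finset.measurable_sum _ fun k _ => (measurable_from_top (f := φ k)).comp (measurable_pi_apply k)
  have h := (hind.indepFun_finset s t hst hX).comp (hm s) (hm t)
  have e : ∀ u : Finset ι, ((fun v : u → ℤ => ∑ k : u, φ k (v k)) ∘ fun ω (i : u) => X i ω) =
      fun ω => ∑ k ∈ u, φ k (X k ω) := fun u => by
    ext ω
    exact Finset.sum_coe_sort u fun k => φ k (X k ω)
  rwa [e, e] at h

theorem exists_finset_sum_comp_mem {Q : ι → Finset ℤ} (hQ : ∀ k, ∀ᵐ ω ∂μ, X k ω ∈ Q k)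
    {E : Type*} [AddCommGroup E] (φ : ι → ℤ → E) (s : Finset ι) :
    ∃ R : Finset E, ∀ᵐ ω ∂μ, ∑ k ∈ s, φ k (X k ω) ∈ R := by
  classical
  induction s using Finset.induction_on with
  | empty => exact ⟨{0}, by simp⟩
  | insert k s hk ih =>
    obtain ⟨R, hR⟩ := ih
    refine ⟨Finset.image₂ (fun x y => φ k x + y) (Q k) R, ?_⟩
    filter_upwards [hR, hQ k] with ω h1 h2
    rw [Finset.sum_insert hk]
    exact Finset.mem_image₂_of_mem h2 h1

end Sums

/-! ### The symmetric bound for weighted sums. -/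

section Mass

variable {Ω : Type*} [MeasurableSpace Ω] {μ : Measure Ω}

theorem massFunction_mul_add [IsProbabilityMeasure μ] {X : Ω → ℤ} {T : Ω → ℝ} {Q : Finset ℤ}
    {a : ℝ} (ha : a ≠ 0) (hX : Measurable X) (hT : Measurable T)
    (hXT : IndepFun (fun ω => a * (X ω : ℝ)) T μ) (hQ : ∀ᵐ ω ∂μ, X ω ∈ Q) (x : ℝ) :
    massFunction μ (fun ω => a * (X ω : ℝ) + T ω) x =
      ∑ j ∈ Q, massFunction μ X j * massFunction μ T (x - a * j) := by
  have hinj : Function.Injective fun j : ℤ => a * (j : ℝ) := fun i j h => by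
    simpa [ha] using h
  have hmeas : Measurable fun ω => a * (X ω : ℝ) :=
    (measurable_from_top (f := fun j : ℤ => a * (j : ℝ))).comp hX
  rw [massFunction_add (Q := Q.image fun j : ℤ => a * (j : ℝ)) hmeas hXT
    (hQ.mono fun ω h => Finset.mem_image_of_mem _ h) (hmeas.add hT), Finset.sum_image hinj.injOn]
  refine Finset.sum_congr rfl fun j _ => ?_
  have : (fun ω => a * (X ω : ℝ)) ⁻¹' {a * (j : ℝ)} = X ⁻¹' {j} := by
    ext ω
    simp [ha]
  rw [massFunction, this]
  rfl

theorem logConcaveSeq_single : LogConcaveSeq fun z => if z = 0 then 1 else 0 := by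
  refine ⟨fun i => by split_ifs <;> norm_num, fun i j k l h1 h2 h3 => ?_⟩
  by_cases hi : i = 0
  · by_cases hl : l = 0
    · simp [hi, hl, show j = 0 by omega, show k = 0 by omega]
    · simp only [hl, if_false, mul_zero]
      split_ifs <;> norm_num
  · simp only [hi, if_false, zero_mul]
    split_ifs <;> norm_num

theorem massFunction_zero [IsProbabilityMeasure μ] {E : Type*} [Zero E] [DecidableEq E] (x : E) :
    massFunction μ (fun _ => (0 : E)) x = if x = 0 then 1 else 0 := by
  rw [massFunction]
  split_ifs with h
  · simp [h]
  · rw [Set.preimage_const_of_notMem (by simpa [eq_comm] using h), measureReal_empty]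

theorem majorizedBy_single : MajorizedBy (fun x => if x = 0 then 1 else 0)
    (fun z => if z = 0 then 1 else 0) := by
  intro C
  refine ⟨(Finset.range C.card).map (intShift 0), by simp, ?_⟩
  rw [Finset.sum_map, Finset.sum_ite_eq']
  split_ifs with h
  · refine le_trans ?_ (Finset.single_le_sum (f := fun t => if intShift 0 t = 0 then (1 : ℝ) else 0)
      (fun t _ => by split_ifs <;> norm_num) (Finset.mem_range.2 (Finset.card_pos.2 ⟨0, h⟩)))
    simp
  · exact Finset.sum_nonneg fun t _ => by split_ifs <;> norm_num

variable [IsProbabilityMeasure μ] {ι : Type*} {X : ι → Ω → ℤ} {Q : ι → Finset ℤ}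

/-- The unweighted sum of independent symmetric log-concave variables is symmetric log-concave and
majorizes every weighted sum. -/
theorem symmetric_sum_majorizes (hX : ∀ k, Measurable (X k)) (hind : iIndepFun X μ)
    (hQ : ∀ k, ∀ᵐ ω ∂μ, X k ω ∈ Q k) (hlc : ∀ k, LogConcaveSeq (massFunction μ (X k)))
    (hsym : ∀ k, ∃ γ : ℤ, ∀ z, massFunction μ (X k) (γ - z) = massFunction μ (X k) z)
    {a : ι → ℝ} (ha : ∀ k, a k ≠ 0) (s : Finset ι) :
    LogConcaveSeq (massFunction μ fun ω => ∑ k ∈ s, X k ω) ∧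
      (∃ γ : ℤ, ∀ z, massFunction μ (fun ω => ∑ k ∈ s, X k ω) (γ - z) =
        massFunction μ (fun ω => ∑ k ∈ s, X k ω) z) ∧
      MajorizedBy (massFunction μ fun ω => ∑ k ∈ s, a k * (X k ω : ℝ))
        (massFunction μ fun ω => ∑ k ∈ s, X k ω) := by
  classical
  induction s using Finset.induction_on with
  | empty =>
    simp only [Finset.sum_empty]
    rw [show (massFunction μ fun _ => (0 : ℤ)) = fun z => if z = 0 then 1 else 0 from
      funext massFunction_zero, show (massFunction μ fun _ => (0 : ℝ)) =
        fun z => if z = 0 then 1 else 0 from funext massFunction_zero]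
    exact ⟨logConcaveSeq_single, ⟨0, fun z => by simp⟩, majorizedBy_single⟩
  | insert k s hk ih =>
    obtain ⟨hlcs, ⟨γ, hγ⟩, hmaj⟩ := ih
    obtain ⟨γ', hγ'⟩ := hsym k
    have hdisj : Disjoint {k} s := Finset.disjoint_singleton_left.2 hk
    have hQ0 : ∀ z ∉ Q k, massFunction μ (X k) z = 0 := fun z hz => massFunction_eq_zero (hQ k) hz
    have i1 := indepFun_sum_comp_of_disjoint hX hind (fun _ z => z) hdisj
    have i2 := indepFun_sum_comp_of_disjoint hX hind (fun k z => a k * (z : ℝ)) hdisj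
    simp only [Finset.sum_singleton] at i1 i2
    have m1 := measurable_sum_comp hX (fun _ z => z) s
    have m2 := measurable_sum_comp hX (fun k z => a k * (z : ℝ)) s
    have e1 : ∀ z, massFunction μ (fun ω => ∑ k ∈ insert k s, X k ω) z =
        ∑ t ∈ Q k, massFunction μ (X k) t * massFunction μ (fun ω => ∑ k ∈ s, X k ω) (z - t) := by
      intro z
      simp only [Finset.sum_insert hk]
      exact massFunction_add (hX k) i1 (hQ k) ((hX k).add m1) z
    have e2 : ∀ x, massFunction μ (fun ω => ∑ k ∈ insert k s, a k * (X k ω : ℝ)) x =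
        ∑ t ∈ Q k, massFunction μ (X k) t *
          massFunction μ (fun ω => ∑ k ∈ s, a k * (X k ω : ℝ)) (x - a k * t) := by
      intro x
      simp only [Finset.sum_insert hk]
      exact massFunction_mul_add (ha k) (hX k) m2 i2 (hQ k) x
    refine ⟨(hlc k).conv hlcs (Q k) hQ0 e1, ⟨γ' + γ, fun z => ?_⟩, ?_⟩
    · rw [e1, e1]
      have h := LogConcaveSeq.sum_reflect hQ0 hγ' fun t =>
        massFunction μ (fun ω => ∑ k ∈ s, X k ω) (γ' + γ - z - t)
      simp only [mul_comm (massFunction μ (X k) _)]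
      rw [← h]
      refine Finset.sum_congr rfl fun t _ => ?_
      rw [← hγ (z - t)]
      congr 2
      ring
    · rw [funext e1, funext e2]
      exact hmaj.conv (fun x y h => hlcs.le_of_abs_le hγ h) (hlc k).nonneg
        (fun x y h => (hlc k).le_of_abs_le hγ' h) hQ0 (ha k)

theorem variance_sum_intCast (hX : ∀ k, Measurable (X k)) (hind : iIndepFun X μ)
    (hQ : ∀ k, ∀ᵐ ω ∂μ, X k ω ∈ Q k) (s : Finset ι) :
    variance (fun ω => ((∑ k ∈ s, X k ω : ℤ) : ℝ)) μ =
      ∑ k ∈ s, variance (fun ω => (X k ω : ℝ)) μ := by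
  rw [← IndepFun.variance_sum (X := fun k ω => (X k ω : ℝ)) fun k _ => memLp_intCast (hX k) (hQ k)]
  · congr 1
    ext ω
    simp
  · intro i _ j _ hij
    exact (hind.indepFun hij).comp (φ := fun z : ℤ => (z : ℝ)) (ψ := fun z : ℤ => (z : ℝ))
      measurable_from_top measurable_from_top

/-- The maximal probability of a weighted sum of independent symmetric log-concave variables. -/
theorem massFunction_sq_mul_le_of_symmetric (hX : ∀ k, Measurable (X k)) (hind : iIndepFun X μ)
    (hQ : ∀ k, ∀ᵐ ω ∂μ, X k ω ∈ Q k) (hlc : ∀ k, LogConcaveSeq (massFunction μ (X k)))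
    (hsym : ∀ k, ∃ γ : ℤ, ∀ z, massFunction μ (X k) (γ - z) = massFunction μ (X k) z)
    {a : ι → ℝ} (ha : ∀ k, a k ≠ 0) (s : Finset ι) (x : ℝ) :
    massFunction μ (fun ω => ∑ k ∈ s, a k * (X k ω : ℝ)) x ^ 2 *
      (1 + 2 * ∑ k ∈ s, variance (fun ω => (X k ω : ℝ)) μ) ≤ 1 := by
  obtain ⟨h1, ⟨γ, hγ⟩, hmaj⟩ := symmetric_sum_majorizes hX hind hQ hlc hsym ha s
  obtain ⟨R, hR⟩ := exists_finset_sum_comp_mem hQ (fun _ z => z) s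
  have hm := measurable_sum_comp hX (fun _ z => z) s
  rw [← variance_sum_intCast hX hind hQ, variance_eq_sum hm hR]
  obtain ⟨D, hD, hle⟩ := hmaj {x}
  rw [Finset.card_singleton, Finset.card_eq_one] at hD
  obtain ⟨z, rfl⟩ := hD
  rw [Finset.sum_singleton, Finset.sum_singleton] at hle
  refine le_trans ?_ (h1.sq_mul_le_one_of_symmetric (fun z hz => massFunction_eq_zero hR hz)
    (sum_massFunction hm hR) hγ z)
  rw [← variance_eq_sum hm hR]
  have := variance_nonneg (fun ω => ((∑ k ∈ s, X k ω : ℤ) : ℝ)) μ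
  have := massFunction_nonneg (μ := μ) (fun ω => ∑ k ∈ s, a k * (X k ω : ℝ)) x
  gcongr

end Mass

/-! ### Symmetrization and collision probability. -/

section Copies

variable {Ω : Type*} [MeasurableSpace Ω] {μ : Measure Ω} [IsProbabilityMeasure μ] {ι : Type*}
  {X : ι → Ω → ℤ} {Q : ι → Finset ℤ}

/-- The differences of two independent copies of an independent family are independent. -/
theorem iIndepFun_sub_copies [Fintype ι] (hX : ∀ k, Measurable (X k)) (hind : iIndepFun X μ) :
    iIndepFun (fun k (ω : Ω × Ω) => X k ω.1 - X k ω.2) (μ.prod μ) := by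
  have := fun k => Measure.isProbabilityMeasure_map (μ := μ) (hX k).aemeasurable
  have hpair : iIndepFun (fun k (ω : Ω × Ω) => (X k ω.1, X k ω.2)) (μ.prod μ) := by
    rw [iIndepFun_iff_map_fun_eq_pi_map fun k => by fun_prop]
    have h1 : ∀ k, (μ.prod μ).map (fun ω : Ω × Ω => (X k ω.1, X k ω.2)) =
        (μ.map (X k)).prod (μ.map (X k)) := fun k => (Measure.map_prod_map μ μ (hX k) (hX k)).symm
    have h2 := hind.map_fun_eq_pi_map fun k => (hX k).aemeasurable
    have hm : Measurable fun ω k => X k ω := measurable_pi_lambda _ hX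
    simp only [h1]
    have h3 := (measurePreserving_arrowProdEquivProdArrow ℤ ℤ ι (fun k => μ.map (X k))
      (fun k => μ.map (X k))).symm
    rw [← h3.map_eq, ← h2, Measure.map_prod_map μ μ hm hm,
      Measure.map_map (MeasurableEquiv.measurable _) (by fun_prop)]
    rfl
  exact hpair.comp (fun _ p => p.1 - p.2) fun _ => measurable_fst.sub measurable_snd

theorem massFunction_fst {E : Type*}
    [MeasurableSpace E] [MeasurableSingletonClass E] {Y : Ω → E} (hY : Measurable Y) (y : E) :
    massFunction (μ.prod μ) (fun ω => Y ω.1) y = massFunction μ Y y :=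
  measurePreserving_fst.measureReal_preimage (hY (measurableSet_singleton y)).nullMeasurableSet

theorem massFunction_neg_snd {E : Type*} [AddGroup E]
    [MeasurableSpace E] [MeasurableSingletonClass E] {Y : Ω → E} (hY : Measurable Y) (y : E) :
    massFunction (μ.prod μ) (fun ω => -Y ω.2) y = massFunction μ Y (-y) := by
  have h : (fun ω : Ω × Ω => -Y ω.2) ⁻¹' {y} = Prod.snd ⁻¹' (Y ⁻¹' {-y}) := by
    ext ω
    simp [neg_eq_iff_eq_neg]
  rw [massFunction, h]
  exact measurePreserving_snd.measureReal_preimage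
    (hY (measurableSet_singleton _)).nullMeasurableSet

theorem massFunction_sub_copies {E : Type*} [AddCommGroup E] [MeasurableSpace E]
    [MeasurableSingletonClass E] [MeasurableAdd₂ E] [MeasurableNeg E] {Y : Ω → E} {R : Finset E}
    (hY : Measurable Y) (hR : ∀ᵐ ω ∂μ, Y ω ∈ R) (x : E) :
    massFunction (μ.prod μ) (fun ω => Y ω.1 - Y ω.2) x =
      ∑ y ∈ R, massFunction μ Y y * massFunction μ Y (y - x) := by
  have h1 : Measurable fun ω : Ω × Ω => Y ω.1 := hY.comp measurable_fst
  have h2 : Measurable fun ω : Ω × Ω => -Y ω.2 := (hY.comp measurable_snd).neg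
  simp only [sub_eq_add_neg (Y _)]
  rw [massFunction_add (Y := fun ω : Ω × Ω => -Y ω.2) h1 (indepFun_prod hY hY.neg)
    (Measure.quasiMeasurePreserving_fst.ae hR) (h1.add h2)]
  refine Finset.sum_congr rfl fun y _ => ?_
  rw [massFunction_fst hY, massFunction_neg_snd hY, neg_sub]

theorem variance_sub_copies {R : Finset ℤ} {Y : Ω → ℤ} (hY : Measurable Y)
    (hR : ∀ᵐ ω ∂μ, Y ω ∈ R) :
    variance (fun ω : Ω × Ω => ((Y ω.1 - Y ω.2 : ℤ) : ℝ)) (μ.prod μ) =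
      2 * variance (fun ω => (Y ω : ℝ)) μ := by
  have hL := memLp_intCast hY hR
  have hm : Measurable fun ω => (Y ω : ℝ) := (measurable_from_top (f := fun z : ℤ => (z : ℝ))).comp hY
  have hL1 : MemLp (fun ω : Ω × Ω => (Y ω.1 : ℝ)) 2 (μ.prod μ) :=
    hL.comp_measurePreserving measurePreserving_fst
  have hL2 : MemLp (fun ω : Ω × Ω => -(Y ω.2 : ℝ)) 2 (μ.prod μ) :=
    (hL.comp_measurePreserving measurePreserving_snd).neg
  have h1 : variance (fun ω : Ω × Ω => (Y ω.1 : ℝ)) (μ.prod μ) = variance (fun ω => (Y ω : ℝ)) μ := by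
    have := variance_map (X := fun ω => (Y ω : ℝ)) (μ := μ.prod μ) (Y := Prod.fst)
      (by rw [measurePreserving_fst.map_eq]; exact hm.aemeasurable) measurable_fst.aemeasurable
    rw [measurePreserving_fst.map_eq] at this
    exact this.symm
  have h2 : variance (fun ω : Ω × Ω => -(Y ω.2 : ℝ)) (μ.prod μ) =
      variance (fun ω => (Y ω : ℝ)) μ := by
    have := variance_map (X := fun ω => (Y ω : ℝ)) (μ := μ.prod μ) (Y := Prod.snd)
      (by rw [measurePreserving_snd.map_eq]; exact hm.aemeasurable) measurable_snd.aemeasurable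
    rw [measurePreserving_snd.map_eq] at this
    rw [this]
    exact variance_neg
  have h3 := IndepFun.variance_fun_add hL1 hL2 (indepFun_prod hm hm.neg)
  rw [h1, h2] at h3
  rw [two_mul, ← h3]
  congr 1
  ext ω
  push_cast
  ring

/-- The collision probability of a weighted sum of independent log-concave variables. -/
theorem sum_massFunction_sq_sq_mul_le [Fintype ι] (hX : ∀ k, Measurable (X k))
    (hind : iIndepFun X μ) (hQ : ∀ k, ∀ᵐ ω ∂μ, X k ω ∈ Q k)
    (hlc : ∀ k, LogConcaveSeq (massFunction μ (X k))) {a : ι → ℝ} (ha : ∀ k, a k ≠ 0)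
    (s : Finset ι) {R : Finset ℝ} (hR : ∀ᵐ ω ∂μ, ∑ k ∈ s, a k * (X k ω : ℝ) ∈ R) :
    (∑ y ∈ R, massFunction μ (fun ω => ∑ k ∈ s, a k * (X k ω : ℝ)) y ^ 2) ^ 2 *
      (1 + 4 * ∑ k ∈ s, variance (fun ω => (X k ω : ℝ)) μ) ≤ 1 := by
  classical
  set Z : ι → Ω × Ω → ℤ := fun k ω => X k ω.1 - X k ω.2 with hZ
  have hmass : ∀ k x, massFunction (μ.prod μ) (Z k) x =
      ∑ y ∈ Q k, massFunction μ (X k) y * massFunction μ (X k) (y - x) := fun k x =>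
    massFunction_sub_copies (hX k) (hQ k) x
  have hQ0 : ∀ k, ∀ z ∉ Q k, massFunction μ (X k) z = 0 := fun k z hz =>
    massFunction_eq_zero (hQ k) hz
  have hZlc : ∀ k, LogConcaveSeq (massFunction (μ.prod μ) (Z k)) := fun k =>
    (hlc k).conv (hlc k).neg (Q k) (hQ0 k) fun x => by
      rw [hmass]
      exact Finset.sum_congr rfl fun y _ => by rw [neg_sub]
  have hZsym : ∀ k, ∃ γ : ℤ, ∀ z, massFunction (μ.prod μ) (Z k) (γ - z) =
      massFunction (μ.prod μ) (Z k) z := by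
    refine fun k => ⟨0, fun z => ?_⟩
    have h1 : ∀ z, massFunction (μ.prod μ) (Z k) z =
        ∑' y, massFunction μ (X k) y * massFunction μ (X k) (y - z) := fun z => by
      rw [hmass, tsum_eq_sum fun y hy => by rw [hQ0 k y hy, zero_mul]]
    rw [h1, h1, ← (Equiv.addRight (-z)).tsum_eq]
    refine tsum_congr fun y => ?_
    rw [Equiv.coe_addRight, mul_comm]
    (congr 2; ring)
  have hZQ : ∀ k, ∀ᵐ ω ∂(μ.prod μ), Z k ω ∈ Finset.image₂ (fun x y => x - y) (Q k) (Q k) := fun k => by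
    filter_upwards [Measure.quasiMeasurePreserving_fst.ae (hQ k),
      Measure.quasiMeasurePreserving_snd.ae (hQ k)] with ω h1 h2
    exact Finset.mem_image₂_of_mem h1 h2
  -- At the point 0 the mass of the difference of two copies is the collision probability; the
  -- doubled variance turns the constant 2 into 4.
  have h := massFunction_sq_mul_le_of_symmetric (μ := μ.prod μ) (X := Z)
    (fun k => ((hX k).comp measurable_fst).sub ((hX k).comp measurable_snd))
    (iIndepFun_sub_copies hX hind) hZQ hZlc hZsym ha s 0
  have hsum : (fun ω : Ω × Ω => ∑ k ∈ s, a k * (Z k ω : ℝ)) = fun ω : Ω × Ω =>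
      (∑ k ∈ s, a k * (X k ω.1 : ℝ)) - ∑ k ∈ s, a k * (X k ω.2 : ℝ) := by
    ext ω
    rw [← Finset.sum_sub_distrib]
    refine Finset.sum_congr rfl fun k _ => ?_
    simp only [hZ]
    push_cast
    ring
  have hm := measurable_sum_comp hX (fun k z => a k * (z : ℝ)) s
  rw [hsum, massFunction_sub_copies hm hR] at h
  simp only [sub_zero, ← sq] at h
  have hvar : ∀ k, variance (fun ω => (Z k ω : ℝ)) (μ.prod μ) =
      2 * variance (fun ω => (X k ω : ℝ)) μ := fun k => variance_sub_copies (hX k) (hQ k)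
  simp only [hvar, ← Finset.mul_sum, ← mul_assoc] at h
  norm_num at h
  exact h

end Copies

/-! ### The largest mass without symmetry. -/

/-- If all terms are small, a finite sum of nonnegative reals can be split evenly. -/
theorem exists_balanced_subset {ι : Type*} [DecidableEq ι] (s : Finset ι) (v : ι → ℝ)
    (hv : ∀ k, 0 ≤ v k) (hs : s.Nonempty) (hsmall : ∀ k ∈ s, v k < (∑ k ∈ s, v k) / 14) :
    ∃ t ⊂ s, (∑ k ∈ t, v k + ∑ k ∈ s \ t, v k) ^ 2 ≤
      16 * (∑ k ∈ t, v k) * ∑ k ∈ s \ t, v k := by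
  set V := ∑ k ∈ s, v k with hV
  have hV0 : 0 < V := by
    obtain ⟨k, hk⟩ := hs
    linarith [hsmall k hk, hv k]
  obtain ⟨t, ht, hmax⟩ := Finset.exists_max_image
    ({t ∈ s.powerset | ∑ k ∈ t, v k ≤ V / 2} : Finset (Finset ι)) (fun t => ∑ k ∈ t, v k)
    ⟨∅, by simpa using by positivity⟩
  rw [Finset.mem_filter, Finset.mem_powerset] at ht
  obtain ⟨hts, htV⟩ := ht
  have hsplit : ∑ k ∈ s \ t, v k + ∑ k ∈ t, v k = V := Finset.sum_sdiff hts
  -- Otherwise one more positive term would keep the sum below `V / 2`, as `3/7 + 1/14 = 1/2`,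
  -- against maximality.
  have hlow : 3 / 7 * V ≤ ∑ k ∈ t, v k := by
    by_contra! hcon
    have : 0 < ∑ k ∈ s \ t, v k := by linarith
    obtain ⟨k, hk, hvk⟩ := Finset.exists_lt_of_sum_lt (f := fun _ => (0 : ℝ)) (s := s \ t) (g := v)
      (by simpa using this)
    obtain ⟨hks, hkt⟩ := Finset.mem_sdiff.1 hk
    have hle := hsmall k hks
    have hins := Finset.sum_insert (f := v) hkt
    have := hmax (insert k t) (Finset.mem_filter.2 ⟨Finset.mem_powerset.2
      (Finset.insert_subset hks hts), by rw [hins]; linarith⟩)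
    simp only [hins] at this
    linarith
  refine ⟨t, hts.ssubset_of_ne ?_, ?_⟩
  · rintro rfl
    linarith
  · have h2 : ∑ k ∈ s \ t, v k = V - ∑ k ∈ t, v k := by linarith
    rw [h2]
    nlinarith

theorem sum_massFunction_le {Ω E : Type*} [MeasurableSpace Ω] {μ : Measure Ω} {Y : Ω → E} {R : Finset E}
    (hR : ∀ᵐ ω ∂μ, Y ω ∈ R) (C : Finset E) : ∑ y ∈ C, massFunction μ Y y ≤ ∑ y ∈ R, massFunction μ Y y := by
  classical
  rw [← Finset.sum_inter_add_sum_sdiff C R, Finset.sum_eq_zero (s := C \ R), add_zero]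
  · exact Finset.sum_le_sum_of_subset_of_nonneg Finset.inter_subset_right
      fun _ _ _ => massFunction_nonneg _ _
  · exact fun y hy => massFunction_eq_zero hR (Finset.mem_sdiff.1 hy).2

section General

variable {Ω : Type*} [MeasurableSpace Ω] {μ : Measure Ω} [IsProbabilityMeasure μ] {ι : Type*}
  {X : ι → Ω → ℤ} {Q : ι → Finset ℤ}

/-- Cauchy–Schwarz applied to the convolution formula. -/
theorem massFunction_add_sq_le {Y T : Ω → ℝ} {R R' : Finset ℝ} (hY : Measurable Y)
    (hT : Measurable T) (hYT : IndepFun Y T μ) (hR : ∀ᵐ ω ∂μ, Y ω ∈ R) (hR' : ∀ᵐ ω ∂μ, T ω ∈ R')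
    (x : ℝ) : massFunction μ (fun ω => Y ω + T ω) x ^ 2 ≤
      (∑ y ∈ R, massFunction μ Y y ^ 2) * ∑ y ∈ R', massFunction μ T y ^ 2 := by
  rw [massFunction_add hY hYT hR (hY.add hT)]
  refine (Finset.sum_mul_sq_le_sq_mul_sq _ _ _).trans ?_
  refine mul_le_mul_of_nonneg_left ?_ (Finset.sum_nonneg fun _ _ => sq_nonneg _)
  have hinj : Function.Injective fun y : ℝ => x - y := sub_right_injective
  rw [← Finset.sum_image (f := fun y => massFunction μ T y ^ 2) (g := fun y => x - y) hinj.injOn]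
  classical
  rw [← Finset.sum_filter_add_sum_filter_not _ (· ∈ R')]
  rw [Finset.sum_eq_zero (s := Finset.filter (fun y => ¬ y ∈ R') _), add_zero]
  · exact Finset.sum_le_sum_of_subset_of_nonneg (fun y hy => (Finset.mem_filter.1 hy).2)
      fun _ _ _ => sq_nonneg _
  · intro y hy
    rw [massFunction_eq_zero hR' (Finset.mem_filter.1 hy).2, sq, mul_zero]

theorem sq_mul_le_one_of_sq_le_mul {M q q' V V' : ℝ} (hV : 0 ≤ V) (hV' : 0 ≤ V')
    (hM : M ^ 2 ≤ q * q') (hq : q ^ 2 * (1 + 4 * V) ≤ 1) (hq' : q' ^ 2 * (1 + 4 * V') ≤ 1)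
    (hVV : (1 + (V + V')) ^ 2 ≤ (1 + 4 * V) * (1 + 4 * V')) : M ^ 2 * (1 + (V + V')) ≤ 1 := by
  have h0 : 0 ≤ M ^ 2 * (1 + (V + V')) := by positivity
  refine (sq_le_one_iff₀ h0).1 ?_
  calc (M ^ 2 * (1 + (V + V'))) ^ 2 = (M ^ 2) ^ 2 * (1 + (V + V')) ^ 2 := by ring
    _ ≤ (q * q') ^ 2 * ((1 + 4 * V) * (1 + 4 * V')) := by gcongr
    _ = (q ^ 2 * (1 + 4 * V)) * (q' ^ 2 * (1 + 4 * V')) := by ring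
    _ ≤ 1 := mul_le_one₀ hq (by positivity) hq'

/-- The maximal probability of a weighted sum of independent log-concave variables. -/
theorem massFunction_sq_mul_le [Fintype ι] (hX : ∀ k, Measurable (X k))
    (hind : iIndepFun X μ) (hQ : ∀ k, ∀ᵐ ω ∂μ, X k ω ∈ Q k)
    (hlc : ∀ k, LogConcaveSeq (massFunction μ (X k))) {a : ι → ℝ} (ha : ∀ k, a k ≠ 0)
    (s : Finset ι) (x : ℝ) : massFunction μ (fun ω => ∑ k ∈ s, a k * (X k ω : ℝ)) x ^ 2 *
      (1 + ∑ k ∈ s, variance (fun ω => (X k ω : ℝ)) μ) ≤ 1 := by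
  classical
  set v : ι → ℝ := fun k => variance (fun ω => (X k ω : ℝ)) μ with hv
  have hv0 : ∀ k, 0 ≤ v k := fun k => variance_nonneg _ _
  have hsum0 : ∀ t : Finset ι, 0 ≤ ∑ k ∈ t, v k := fun t => Finset.sum_nonneg fun k _ => hv0 k
  have hm := measurable_sum_comp hX (fun k z => a k * (z : ℝ))
  have hfin := exists_finset_sum_comp_mem (E := ℝ) hQ (fun k z => a k * (z : ℝ))
  have cauchy : ∀ s : Finset ι, ∀ t ⊆ s, (1 + (∑ k ∈ t, v k + ∑ k ∈ s \ t, v k)) ^ 2 ≤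
      (1 + 4 * ∑ k ∈ t, v k) * (1 + 4 * ∑ k ∈ s \ t, v k) →
      ∀ x : ℝ, massFunction μ (fun ω => ∑ k ∈ s, a k * (X k ω : ℝ)) x ^ 2 *
        (1 + ∑ k ∈ s, v k) ≤ 1 := by
    intro s t hts hle x
    obtain ⟨R, hR⟩ := hfin t
    obtain ⟨R', hR'⟩ := hfin (s \ t)
    have hadd : (fun ω => ∑ k ∈ s, a k * (X k ω : ℝ)) = fun ω =>
        (∑ k ∈ t, a k * (X k ω : ℝ)) + ∑ k ∈ s \ t, a k * (X k ω : ℝ) := by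
      ext ω
      rw [add_comm, Finset.sum_sdiff hts]
    rw [hadd, ← Finset.sum_sdiff hts, add_comm (∑ k ∈ s \ t, v k)]
    exact sq_mul_le_one_of_sq_le_mul (hsum0 _) (hsum0 _)
      (massFunction_add_sq_le (hm t) (hm (s \ t)) (indepFun_sum_comp_of_disjoint hX hind
        (fun k z => a k * (z : ℝ)) Finset.disjoint_sdiff) hR hR' x)
      (sum_massFunction_sq_sq_mul_le hX hind hQ hlc ha t hR)
      (sum_massFunction_sq_sq_mul_le hX hind hQ hlc ha (s \ t) hR') hle
  induction s using Finset.strongInduction generalizing x with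
  | H s ih =>
    rcases s.eq_empty_or_nonempty with rfl | hne
    · simp only [Finset.sum_empty, add_zero, mul_one]
      exact pow_le_one₀ (massFunction_nonneg _ _) measureReal_le_one
    by_cases hbig : ∃ k ∈ s, (∑ k ∈ s, v k) / 14 ≤ v k
    · obtain ⟨k, hk, hkbig⟩ := hbig
      have hsplit := Finset.add_sum_erase s v hk
      have hk0 := hv0 k
      have hr0 := hsum0 (s.erase k)
      by_cases hdom : 2 + 13 * ∑ k ∈ s.erase k, v k ≤ v k
      · have hIH := ih _ (Finset.erase_ssubset hk)
        have hadd : (fun ω => ∑ k ∈ s, a k * (X k ω : ℝ)) = fun ω =>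
            a k * (X k ω : ℝ) + ∑ k ∈ s.erase k, a k * (X k ω : ℝ) := by
          ext ω
          rw [Finset.add_sum_erase s (fun k => a k * (X k ω : ℝ)) hk]
        have hind' := indepFun_sum_comp_of_disjoint hX hind (fun k z => a k * (z : ℝ))
          (Finset.disjoint_singleton_left.2 (Finset.notMem_erase k s))
        simp only [Finset.sum_singleton] at hind'
        rw [hadd, massFunction_mul_add (ha k) (hX k) (hm _) hind' (hQ k)]
        set T : Ω → ℝ := fun ω => ∑ k ∈ s.erase k, a k * (X k ω : ℝ) with hT
        have hm2 : √(1 + ∑ k ∈ s.erase k, v k) ^ 2 = 1 + ∑ k ∈ s.erase k, v k :=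
          Real.sq_sqrt (by linarith)
        have hinj : Function.Injective fun j : ℤ => x - a k * (j : ℝ) := fun i j h => by
          simpa [ha k] using h
        have hR1 : ∑ j ∈ Q k, massFunction μ T (x - a k * j) ≤ 1 := by
          obtain ⟨R, hR⟩ := hfin (s.erase k)
          rw [← sum_massFunction (hm (s.erase k)) hR,
            ← Finset.sum_image (f := massFunction μ T) (g := fun j : ℤ => x - a k * (j : ℝ)) hinj.injOn]
          exact sum_massFunction_le hR _
        have h := (hlc k).sum_mul_sq_le (F := Q k) (R := fun j => massFunction μ T (x - a k * j))
          (m := √(1 + ∑ k ∈ s.erase k, v k)) (V := v k)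
          (fun z hz => massFunction_eq_zero (hQ k) hz) (sum_massFunction (hX k) (hQ k))
          (variance_eq_sum (hX k) (hQ k)) (fun z => massFunction_nonneg _ _)
          (fun z => (sq_le_one_iff₀ (mul_nonneg (Real.sqrt_nonneg _) (massFunction_nonneg _ _))).1
            (by rw [mul_pow, hm2, mul_comm]; exact hIH _))
          hR1 (Real.one_le_sqrt.2 (by linarith)) (by rw [hm2]; linarith)
        rw [hm2, show v k + (1 + ∑ k ∈ s.erase k, v k) = 1 + ∑ k ∈ s, v k by rw [← hsplit]; ring] at h
        simpa only [mul_comm (massFunction μ (X k) _)] using h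
      · refine cauchy s {k} (Finset.singleton_subset_iff.2 hk) ?_ x
        rw [Finset.sum_singleton, Finset.sdiff_singleton_eq_erase]
        rcases le_total (v k) (∑ k ∈ s.erase k, v k) with h | h <;> nlinarith
    · push Not at hbig
      obtain ⟨t, hts, hle⟩ := exists_balanced_subset s v hv0 hne hbig
      refine cauchy s t hts.1 ?_ x
      nlinarith [hsum0 t, hsum0 (s \ t)]

end General

/-! ### From mass bounds to Rényi entropies. -/

theorem le_renyiEntropyPower_of_sq_mul_le {Ω E : Type*} [MeasurableSpace Ω] {μ : Measure Ω}
    {b B : ℝ} {α : ℝ≥0∞} {Y : Ω → E} (hb : 0 < b) (hB : b ^ 2 * B ≤ 1) (h : -Real.log b ≤ renyiEntropy μ α Y) :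
    B ≤ renyiEntropyPower μ α Y := by
  rw [renyiEntropyPower]
  calc B ≤ (b ^ 2)⁻¹ := by rw [← one_div, le_div_iff₀ (by positivity)]; linarith
    _ = Real.exp (2 * -Real.log b) := by
      rw [mul_neg, Real.exp_neg, mul_comm, Real.exp_mul, Real.exp_log hb]
      norm_num
    _ ≤ _ := Real.exp_le_exp.2 (by linarith)

section Renyi

variable {Ω : Type*} [MeasurableSpace Ω] {μ : Measure Ω} [IsProbabilityMeasure μ] {E : Type*}
  [MeasurableSpace E] [MeasurableSingletonClass E] {Y : Ω → E} {R : Finset E}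

theorem exists_massFunction_pos (hY : Measurable Y) (hR : ∀ᵐ ω ∂μ, Y ω ∈ R) :
    ∃ y ∈ R, 0 < massFunction μ Y y := by
  by_contra! hcon
  have h1 := sum_massFunction hY hR
  rw [Finset.sum_eq_zero fun y hy => le_antisymm (hcon y hy) (massFunction_nonneg Y y)] at h1
  exact zero_ne_one h1

theorem neg_log_le_renyiEntropy (hY : Measurable Y) (hR : ∀ᵐ ω ∂μ, Y ω ∈ R) {b : ℝ}
    (hb : ∀ y, massFunction μ Y y ≤ b) (α : ℝ≥0∞) : -Real.log b ≤ renyiEntropy μ α Y := by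
  have h1 := sum_massFunction hY hR
  have h0 : ∀ y, 0 ≤ massFunction μ Y y := massFunction_nonneg Y
  have hz : ∀ y ∉ R, massFunction μ Y y = 0 := fun y hy => massFunction_eq_zero hR hy
  obtain ⟨y₀, hy₀R, hy₀⟩ := exists_massFunction_pos hY hR
  have hbpos : 0 < b := hy₀.trans_le (hb y₀)
  rw [renyiEntropy]
  split_ifs with hα0 hα1 hαtop
  · rw [← Real.log_inv]
    refine Real.log_le_log (inv_pos.2 hbpos) ?_
    have hfin : (Function.support (massFunction μ Y)).Finite :=
      R.finite_toSet.subset fun y hy => by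
        by_contra h
        exact hy (hz y h)
    rw [inv_le_iff_one_le_mul₀ hbpos, Set.ncard_eq_toFinset_card _ hfin, ← nsmul_eq_mul]
    calc (1 : ℝ) = ∑ y ∈ R, massFunction μ Y y := h1.symm
      _ ≤ ∑ y ∈ hfin.toFinset, massFunction μ Y y := by
        rw [← Finset.sum_filter_ne_zero]
        refine Finset.sum_le_sum_of_subset_of_nonneg (fun y hy => ?_) fun y _ _ => h0 y
        exact (Set.Finite.mem_toFinset hfin).2 (Finset.mem_filter.1 hy).2
      _ ≤ hfin.toFinset.card • b := Finset.sum_le_card_nsmul _ _ _ fun y _ => hb y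
  · rw [tsum_eq_sum fun y hy => by rw [hz y hy, zero_mul], neg_le_neg_iff]
    calc ∑ y ∈ R, massFunction μ Y y * Real.log (massFunction μ Y y)
        ≤ ∑ y ∈ R, massFunction μ Y y * Real.log b := by
          refine Finset.sum_le_sum fun y _ => ?_
          rcases (h0 y).eq_or_lt with h | h
          · rw [← h]; simp
          · exact mul_le_mul_of_nonneg_left (Real.log_le_log h (hb y)) (h0 y)
      _ = Real.log b := by rw [← Finset.sum_mul, h1, one_mul]
  · rw [neg_le_neg_iff]
    have : Nonempty E := ⟨y₀⟩
    refine Real.log_le_log (hy₀.trans_le (le_ciSup ⟨b, ?_⟩ y₀)) (ciSup_le hb)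
    rintro _ ⟨y, rfl⟩
    exact hb y
  · set r := α.toReal with hr
    have hr0 : 0 < r := ENNReal.toReal_pos hα0 hαtop
    have hr1 : r ≠ 1 := fun h => hα1 <| by
      rw [← ENNReal.ofReal_toReal hαtop, ← hr, h, ENNReal.ofReal_one]
    rw [tsum_eq_sum fun y hy => by rw [hz y hy, Real.zero_rpow hr0.ne']]
    have hpos : 0 < ∑ y ∈ R, massFunction μ Y y ^ r := by
      refine lt_of_lt_of_le (Real.rpow_pos_of_pos hy₀ r) (Finset.single_le_sum
        (f := fun y => massFunction μ Y y ^ r) (fun y _ => Real.rpow_nonneg (h0 y) r) hy₀R)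
    have hpow : ∀ y, massFunction μ Y y ^ r = massFunction μ Y y * massFunction μ Y y ^ (r - 1) := by
      intro y
      rcases (h0 y).eq_or_lt with h | h
      · rw [← h, Real.zero_rpow hr0.ne', zero_mul]
      · rw [Real.rpow_sub_one h.ne']; field_simp
    have hbsum : ∑ y ∈ R, massFunction μ Y y * b ^ (r - 1) = b ^ (r - 1) := by
      rw [← Finset.sum_mul, h1, one_mul]
    rcases lt_or_gt_of_ne hr1 with hlt | hgt
    · have hle : b ^ (r - 1) ≤ ∑ y ∈ R, massFunction μ Y y ^ r := by
        rw [← hbsum]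
        refine Finset.sum_le_sum fun y _ => ?_
        rw [hpow]
        rcases (h0 y).eq_or_lt with h | h
        · rw [← h, zero_mul, zero_mul]
        · exact mul_le_mul_of_nonneg_left
            (Real.rpow_le_rpow_of_nonpos h (hb y) (by linarith)) h.le
      have := Real.log_le_log (Real.rpow_pos_of_pos hbpos _) hle
      rw [Real.log_rpow hbpos] at this
      rw [one_div, inv_mul_eq_div, le_div_iff₀ (by linarith)]
      linarith
    · have hle : ∑ y ∈ R, massFunction μ Y y ^ r ≤ b ^ (r - 1) := by
        rw [← hbsum]
        refine Finset.sum_le_sum fun y _ => ?_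
        rw [hpow]
        exact mul_le_mul_of_nonneg_left
          (Real.rpow_le_rpow (h0 y) (hb y) (by linarith)) (h0 y)
      have := Real.log_le_log hpos hle
      rw [Real.log_rpow hbpos] at this
      rw [one_div, inv_mul_eq_div, le_div_iff_of_neg (by linarith)]
      linarith

/-- Jensen for the exponent `1 / (r - 1)`, which is at least 1 exactly because `1 < r ≤ 2`, with the
masses as weights and `p ^ (r - 1)` as values. -/
theorem neg_log_sum_sq_le_renyiEntropy (hY : Measurable Y) (hR : ∀ᵐ ω ∂μ, Y ω ∈ R) {α : ℝ≥0∞}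
    (hα1 : 1 < α) (hα2 : α ≤ 2) :
    -Real.log (∑ y ∈ R, massFunction μ Y y ^ 2) ≤ renyiEntropy μ α Y := by
  have h1 := sum_massFunction hY hR
  have h0 : ∀ y, 0 ≤ massFunction μ Y y := massFunction_nonneg Y
  have hz : ∀ y ∉ R, massFunction μ Y y = 0 := fun y hy => massFunction_eq_zero hR hy
  obtain ⟨y₀, hy₀R, hy₀⟩ := exists_massFunction_pos hY hR
  have hαtop : α ≠ ∞ := (hα2.trans_lt (by simp)).ne
  set r := α.toReal with hr
  have hr1 : 1 < r := by
    rw [hr, ← ENNReal.toReal_one]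
    exact (ENNReal.toReal_lt_toReal (by simp) hαtop).2 hα1
  have hr2 : r ≤ 2 := by
    have := (ENNReal.toReal_le_toReal hαtop (by simp)).2 hα2
    simpa using this
  rw [renyiEntropy, if_neg (zero_lt_one.trans hα1).ne', if_neg hα1.ne', if_neg hαtop, ← hr,
    tsum_eq_sum fun y hy => by rw [hz y hy, Real.zero_rpow (by linarith)]]
  have hpow : ∀ y, massFunction μ Y y ^ r = massFunction μ Y y * massFunction μ Y y ^ (r - 1) := by
    intro y
    rcases (h0 y).eq_or_lt with h | h
    · rw [← h, Real.zero_rpow (by linarith), zero_mul]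
    · rw [Real.rpow_sub_one h.ne']; field_simp
  have hpos : 0 < ∑ y ∈ R, massFunction μ Y y ^ r := by
    refine lt_of_lt_of_le (Real.rpow_pos_of_pos hy₀ r) (Finset.single_le_sum
      (f := fun y => massFunction μ Y y ^ r) (fun y _ => Real.rpow_nonneg (h0 y) r) hy₀R)
  have hpos2 : 0 < ∑ y ∈ R, massFunction μ Y y ^ 2 := by
    refine lt_of_lt_of_le (pow_pos hy₀ 2) (Finset.single_le_sum
      (f := fun y => massFunction μ Y y ^ 2) (fun y _ => sq_nonneg _) hy₀R)
  have hjensen := Real.rpow_arith_mean_le_arith_mean_rpow R (massFunction μ Y)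
    (fun y => massFunction μ Y y ^ (r - 1)) (fun y _ => h0 y) h1
    (fun y _ => Real.rpow_nonneg (h0 y) _) (p := 1 / (r - 1))
    (by rw [le_div_iff₀ (by linarith)]; linarith)
  simp only [← hpow] at hjensen
  have hinv : ∀ y, massFunction μ Y y * (massFunction μ Y y ^ (r - 1)) ^ (1 / (r - 1)) =
      massFunction μ Y y ^ 2 := fun y => by
    rw [← Real.rpow_mul (h0 y), mul_one_div_cancel (by linarith), Real.rpow_one, sq]
  simp only [hinv] at hjensen
  have hlog := Real.log_le_log (Real.rpow_pos_of_pos hpos _) hjensen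
  rw [Real.log_rpow hpos, one_div, inv_mul_eq_div, div_le_iff₀ (by linarith)] at hlog
  rw [one_div, inv_mul_eq_div, le_div_iff_of_neg (by linarith)]
  linarith

end Renyi

theorem SymmetricAboutPoint.exists_reflection {Ω : Type*} [MeasurableSpace Ω] {μ : Measure Ω}
    [IsProbabilityMeasure μ] {X : Ω → ℤ} {Q : Finset ℤ} (hX : Measurable X)
    (hQ : ∀ᵐ ω ∂μ, X ω ∈ Q) (h : SymmetricAboutPoint μ X) :
    ∃ γ : ℤ, ∀ z, massFunction μ X (γ - z) = massFunction μ X z := by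
  obtain ⟨c, hc⟩ := h
  have key : ∀ z : ℤ, massFunction μ X z = μ.real {ω | (X ω : ℝ) = 2 * c - z} := by
    intro z
    have h1 := hc.measure_mem_eq (measurableSet_singleton (z : ℝ))
    have e1 : (fun ω => (X ω : ℝ)) ⁻¹' {(z : ℝ)} = X ⁻¹' {z} := by ext ω; simp
    have e2 : (fun ω => 2 * c - (X ω : ℝ)) ⁻¹' {(z : ℝ)} = {ω | (X ω : ℝ) = 2 * c - z} := by
      ext ω
      simp only [Set.mem_preimage, Set.mem_singleton_iff, Set.mem_ofPred_eq]
      constructor <;> intro h <;> linarith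
    rw [e1, e2] at h1
    rw [massFunction, measureReal_def, measureReal_def, h1]
  obtain ⟨z₀, _, hz₀⟩ := exists_massFunction_pos hX hQ
  -- Reflecting an atom `z₀` gives another integer atom, so `2 * c` is an integer.
  obtain ⟨γ, hγ⟩ : ∃ γ : ℤ, (γ : ℝ) = 2 * c := by
    rw [key] at hz₀
    obtain ⟨ω, hω⟩ := nonempty_of_measureReal_ne_zero hz₀.ne'
    refine ⟨X ω + z₀, ?_⟩
    have : (X ω : ℝ) = 2 * c - z₀ := hω
    push_cast
    linarith
  refine ⟨γ, fun z => ?_⟩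
  rw [key z, ← hγ, massFunction]
  congr 1
  ext ω
  simp only [Set.mem_preimage, Set.mem_singleton_iff, Set.mem_ofPred_eq]
  exact_mod_cast Iff.rfl

theorem theorem1p2 {Ω : Type*} [MeasurableSpace Ω] (μ : Measure Ω) [IsProbabilityMeasure μ]
    (α : ℝ≥0∞) (n : ℕ) (hn : 1 ≤ n) (X : Fin n → Ω → ℤ)
    (hmeas : ∀ k, Measurable (X k))
    (hindep : iIndepFun X μ)
    (hfin : ∀ k, FinitelySupported μ (X k))
    (hlc : ∀ k, DiscreteLogConcave μ (X k)) :
    (∀ a : Fin n → ℝ, (∀ k, a k ≠ 0) →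
      1 + 1 * ∑ k, variance (fun ω => (X k ω : ℝ)) μ ≤
        renyiEntropyPower μ α (fun ω => ∑ k, a k * (X k ω : ℝ))) ∧
    (1 < α ∧ α ≤ 2 →
      ∀ a : Fin n → ℝ, (∀ k, a k ≠ 0) →
        1 + 4 * ∑ k, variance (fun ω => (X k ω : ℝ)) μ ≤
          renyiEntropyPower μ α (fun ω => ∑ k, a k * (X k ω : ℝ))) ∧
    (¬(1 < α ∧ α ≤ 2) → (∀ k, SymmetricAboutPoint μ (X k)) →
      ∀ a : Fin n → ℝ, (∀ k, a k ≠ 0) →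
        1 + 2 * ∑ k, variance (fun ω => (X k ω : ℝ)) μ ≤
          renyiEntropyPower μ α (fun ω => ∑ k, a k * (X k ω : ℝ))) := by
  have hQ := fun k => (hfin k).ae_mem
  have hlc' := fun k => (hlc k).logConcaveSeq
  have hV : 0 ≤ ∑ k, variance (fun ω => (X k ω : ℝ)) μ :=
    Finset.sum_nonneg fun k _ => variance_nonneg _ _
  have hm : ∀ a : Fin n → ℝ, Measurable fun ω => ∑ k, a k * (X k ω : ℝ) := fun a =>
    measurable_sum_comp hmeas (fun k z => a k * (z : ℝ)) Finset.univ
  have hR := fun a : Fin n → ℝ =>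
    exists_finset_sum_comp_mem (E := ℝ) hQ (fun k z => a k * (z : ℝ)) Finset.univ
  have of_bound : ∀ (a : Fin n → ℝ) (B : ℝ), 0 < B →
      (∀ x, massFunction μ (fun ω => ∑ k, a k * (X k ω : ℝ)) x ^ 2 * B ≤ 1) →
      B ≤ renyiEntropyPower μ α (fun ω => ∑ k, a k * (X k ω : ℝ)) := by
    intro a B hB h
    obtain ⟨R, hR⟩ := hR a
    have hb : 0 < √B⁻¹ := Real.sqrt_pos.2 (inv_pos.2 hB)
    refine le_renyiEntropyPower_of_sq_mul_le hb ?_ (neg_log_le_renyiEntropy (hm a) hR (fun x => ?_) α)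
    · rw [Real.sq_sqrt (inv_pos.2 hB).le, inv_mul_cancel₀ hB.ne']
    · refine Real.le_sqrt_of_sq_le ?_
      rw [← one_div, le_div_iff₀ hB]
      exact h x
  refine ⟨fun a ha => ?_, fun hα a ha => ?_, fun _ hsym a ha => ?_⟩
  · rw [one_mul]
    exact of_bound a _ (by positivity) fun x =>
      massFunction_sq_mul_le hmeas hindep hQ hlc' ha Finset.univ x
  · obtain ⟨R, hR⟩ := hR a
    refine le_renyiEntropyPower_of_sq_mul_le ?_
      (sum_massFunction_sq_sq_mul_le hmeas hindep hQ hlc' ha Finset.univ hR)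
      (neg_log_sum_sq_le_renyiEntropy (hm a) hR hα.1 hα.2)
    obtain ⟨y, hyR, hy⟩ := exists_massFunction_pos (hm a) hR
    exact Finset.sum_pos' (fun _ _ => sq_nonneg _) ⟨y, hyR, pow_pos hy 2⟩
  · exact of_bound a _ (by positivity) fun x =>
      massFunction_sq_mul_le_of_symmetric hmeas hindep hQ hlc'
        (fun k => (hsym k).exists_reflection (hmeas k) (hQ k)) ha Finset.univ x
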